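/- **Setting.** Let $K,d,d_X$ be natural numbers, $\mathcal X\subseteq\mathbb R^{d_X}$, $\mathcal A=\{1,\dots,K\}$. At each round $t=1,2,\dots$ a context $X_t\in\mathcal X$ is revealed, an action $A_t\in\mathcal A$ is drawn from a behavior policy, $\mathbb P(A_t=a\mid X_t,\mathcal H_{t-1})=\pi_t(a):=\pi_t(a\mid X_t,\mathcal H_{t-1})$, and the outcome $Y_t=Y_t(A_t)\in\mathbb R$ is observed. Here $\mathcal H_{t-1}=\{X_\tau,\pi_\tau(A_\tau),A_\tau,Y_\tau\}_{\tau<t}$ is the past. The vectors $(X_t,(Y_t(a))_{a\in\mathcal A})$ are i.i.d. with law $\mathcal P$, and each is independent of $\mathcal H_{t-1}$. Unconfoundedness holds: $A_t\perp (Y_t(a))_{a\in\mathcal A}\mid(\mathcal H_{t-1},X_t)$ for all $t$. Write $(X,(Y(a))_{a\in\mathcal A})\sim\mathcal P$. For every arm $a$ let $g_a:\mathcal X\times\mathbb R\times\mathbb R^d\to\mathbb R^d$ be a score function (possibly the same for all arms), measurable in $(x,y)$, and let $\theta_a^*\in\mathbb R^d$ satisfy $\mathbb E\,g_a(X,Y(a);\theta_a^*)=0$.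 All vector norms are Euclidean and all matrix norms are spectral norms. **Assumptions**, with a constant $R_\theta$, for every arm $a\in\mathcal A$: 1. (Well-separated solution) for all $\epsilon>0$, $\inf_{\|\theta-\theta_a^*\|>\epsilon}\|\mathbb E\,g_a(X,Y(a);\theta)\|>0$. 2. (Bounded moments) there is $M_2$ with $\|\mathbb E[g_a(X,Y(a);\theta_a^*)g_a(X,Y(a);\theta_a^*)^\top\mid X]\|\le M_2$ almost surely; $\|\theta_a^*\|<R_\theta$ and $\sup_{\|\theta\|\le R_\theta}\mathbb E\|g_a(X,Y(a);\theta)\|^2<\infty$; $\mathbb E\|g_a(X,Y(a);\theta_a^*)\|^4<\infty$. 3. (Smoothness) $g_a(x,y;\theta)$ is twice differentiable in $\theta$, and $J_a:=\mathbb E\nabla g_a(X,Y(a);\theta_a^*)$ is nonsingular; there is a function $\phi$ with $\sup_{\|\theta\|\le R_\theta}\|\nabla g_a(x,y;\theta)\|\le\phi(x,y)$ for all $x,y$ and $\mathbb E\,\phi(X,Y(a))^2<\infty$; there are $\epsilon_0>0$ and a function $\Phi$ with $\sup_{\|\theta-\theta_a^*\|\le\epsilon_0,\ i\le d}\|\nabla^2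 g_a^{(i)}(x,y;\theta)\|\le\Phi(x,y)$ for all $x,y$ and $\mathbb E\,\Phi(X,Y(a))<\infty$, where $g_a^{(i)}$ is the $i$-th entry of $g_a$. 4. (Minimum sampling probability) there is $\pi_{\min}\in(0,1)$ with $\pi_t(a)\ge\pi_{\min}$ almost surely for all $t$. Finally, the policy converges to a common stationary policy $\bar\pi$, which assigns to each $x\in\mathcal X$ a probability distribution $\bar\pi(\cdot\mid x)$ on $\mathcal A$: for every $a\in\mathcal A$, $\pi_t(a\mid X_t,\mathcal H_{t-1})-\bar\pi(a\mid X_t)\to0$ in probability as $t\to\infty$. **Theorem.** Under these assumptions there exist estimators $\hat\theta_a^{(T)}$, $a\in\mathcal A$, $T\ge1$, each a measurable function of the data of the first $T$ rounds, with $\|\hat\theta_a^{(T)}\|\le R_\theta$ for all $a,T$, such that for every $a\in\mathcal A$ $$G_{a,T}(\hat\theta_a^{(T)})=o_p(1/\sqrt T)\quad(T\to\infty),\qquad G_{a,T}(\theta):=\frac1T\sum_{t=1}^T\frac{1_{\{A_t=a\}}}{\pi_t(A_t)}\,g_a(X_t,Y_t;\theta).$$ Moreover, any such estimators satisfy, as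 $T\to\infty$, $$\sqrt T\,(\hat\theta^{(T)}-\theta^*)\xrightarrow{d}\mathcal N(0,\Sigma^*),$$ where $\hat\theta^{(T)}$ and $\theta^*$ stack the vectors $\hat\theta_a^{(T)}$ and $\theta_a^*$ over $a\in\mathcal A$, and the covariance is block-diagonal, $\Sigma^*=\mathrm{diag}(\Sigma_1^*,\dots,\Sigma_K^*)$, with $$\Sigma_a^*=J_a^{-1}\bar I_a(J_a^{-1})^\top,\qquad \bar I_a=\mathbb E\Big[\frac1{\bar\pi(a\mid X)}\,g_a(X,Y(a);\theta_a^*)\,g_a(X,Y(a);\theta_a^*)^\top\Big].$$ -/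

import Mathlib

open MeasureTheory ProbabilityTheory Filter Matrix
open scoped ENNReal

namespace AdaptiveInference

/-- `ℝⁿ` with the Euclidean norm. -/
abbrev Vec (n : ℕ) : Type := EuclideanSpace ℝ (Fin n)

/-- One recorded round: context, recorded selection probability, action, observed outcome. -/
abbrev Obs {dX : ℕ} (𝒳 : Set (Vec dX)) (K : ℕ) : Type := 𝒳 × ℝ × Fin K × ℝ

/-- A behavior policy: for each round, a measurable map from (past history, current context) to
probability distributions on the `K` actions. Rounds are numbered from `0`, so the history
available at round `t` consists of the `t` rounds `0, …, t - 1`. -/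
abbrev Policy {dX : ℕ} (𝒳 : Set (Vec dX)) (K : ℕ) : Type :=
  (t : ℕ) → Kernel ((Fin t → Obs 𝒳 K) × 𝒳) (Fin K)

/-- The random variables of a contextual bandit experiment on a sample space `Ω`. -/
structure Experiment {dX : ℕ} (𝒳 : Set (Vec dX)) (K : ℕ) (Ω : Type*) where
  /-- the context of round `t` -/
  X : ℕ → Ω → 𝒳
  /-- the vector of potential outcomes `(Y_t(a))_a` of round `t` -/
  Y : ℕ → Ω → Fin K → ℝ
  /-- the action of round `t` -/
  A : ℕ → Ω → Fin K
  /-- the recorded selection probability of round `t` -/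
  p : ℕ → Ω → ℝ

namespace Experiment

variable {dX K : ℕ} {𝒳 : Set (Vec dX)} {Ω : Type*}

/-- The observed outcome `Y_t = Y_t(A_t)`. -/
def Yobs (D : Experiment 𝒳 K Ω) (t : ℕ) (ω : Ω) : ℝ := D.Y t ω (D.A t ω)

/-- The first `t` recorded rounds. This is the history before round `t`, and also the data set
available after `t` rounds. -/
def hist (D : Experiment 𝒳 K Ω) (t : ℕ) (ω : Ω) : Fin t → Obs 𝒳 K :=
  fun s => (D.X s ω, D.p s ω, D.A s ω, D.Yobs s ω)

/-- The σ-algebra generated by the first `t` recorded rounds. -/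
abbrev histSigma (D : Experiment 𝒳 K Ω) (t : ℕ) : MeasurableSpace Ω :=
  MeasurableSpace.comap (D.hist t) inferInstance

/-- The σ-algebra generated by the history before round `t` and the context of round `t`. -/
abbrev preActionSigma (D : Experiment 𝒳 K Ω) (t : ℕ) : MeasurableSpace Ω :=
  MeasurableSpace.comap (fun ω => (D.hist t ω, D.X t ω)) inferInstance

/-- The selection probability `π_t(a) = π_t(a | X_t, H_{t-1})` of the arm `a` at round `t`. -/
noncomputable def prob (D : Experiment 𝒳 K Ω) (π : Policy 𝒳 K) (t : ℕ) (a : Fin K) (ω : Ω) : ℝ :=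
  (π t (D.hist t ω, D.X t ω)).real {a}

/-- The experiment is run in the stochastic environment with law `Q` of
(context, potential outcomes), with actions drawn from the behavior policy `π`. -/
structure IsGenerated [MeasurableSpace Ω] (D : Experiment 𝒳 K Ω) (P : Measure Ω)
    (Q : Measure (𝒳 × (Fin K → ℝ))) (π : Policy 𝒳 K) : Prop where
  measurable_X : ∀ t, Measurable (D.X t)
  measurable_Y : ∀ t, Measurable (D.Y t)
  measurable_A : ∀ t, Measurable (D.A t)
  /-- the contexts and potential outcomes of the rounds are i.i.d. with law `Q` … -/
  hasLaw : ∀ t, HasLaw (fun ω => (D.X t ω, D.Y t ω)) Q P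
  indep : iIndepFun (fun t ω => (D.X t ω, D.Y t ω)) P
  /-- … and those of round `t` are a fresh draw, independent of the recorded past -/
  indep_hist : ∀ t, IndepFun (fun ω => (D.X t ω, D.Y t ω)) (D.hist t) P
  /-- given the past and the current context, the action has law `π_t(· | X_t, H_{t-1})` -/
  action_law : ∀ t a, P⟦D.A t ⁻¹' {a} | D.preActionSigma t⟧ =ᵐ[P] D.prob π t a
  /-- the recorded probability is that of the selected action -/
  recorded : ∀ t ω, D.p t ω = D.prob π t (D.A t ω) ω

/-- Unconfoundedness: for every round, the action is conditionally independent of the vector of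
potential outcomes given the past and the current context. (Conditional independence is spelled
out through conditional probabilities, so that `Ω` may be any probability space.) -/
def Unconfounded [MeasurableSpace Ω] (D : Experiment 𝒳 K Ω) (P : Measure Ω) : Prop :=
  ∀ t, ∀ S : Set (Fin K), ∀ U : Set (Fin K → ℝ), MeasurableSet S → MeasurableSet U →
    P⟦D.A t ⁻¹' S ∩ D.Y t ⁻¹' U | D.preActionSigma t⟧ =ᵐ[P]
      fun ω => (P⟦D.A t ⁻¹' S | D.preActionSigma t⟧) ω * (P⟦D.Y t ⁻¹' U | D.preActionSigma t⟧) ω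

/-- Minimum sampling probability for the arm `a`. -/
def MinSampling [MeasurableSpace Ω] (D : Experiment 𝒳 K Ω) (P : Measure Ω) (π : Policy 𝒳 K)
    (a : Fin K) : Prop :=
  ∃ πmin : ℝ, 0 < πmin ∧ πmin < 1 ∧ ∀ t, ∀ᵐ ω ∂P, πmin ≤ D.prob π t a ω

/-- The behavior policy converges to the stationary policy `πbar`, at every action:
`π_t(a | X_t, H_{t-1}) - πbar(a | X_t) → 0` in probability. -/
def PolicyConverges [MeasurableSpace Ω] (D : Experiment 𝒳 K Ω) (P : Measure Ω) (π : Policy 𝒳 K)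
    (πbar : Kernel 𝒳 (Fin K)) : Prop :=
  ∀ a, TendstoInMeasure P (fun t ω => D.prob π t a ω - (πbar (D.X t ω)).real {a}) atTop
    (fun _ => (0 : ℝ))

/-- The inverse-probability-weighted estimating function
`G_{a,T}(θ) = (1/T) ∑_{t < T} 1{A_t = a} / π_t(A_t) • g(X_t, Y_t; θ)`. -/
noncomputable def ipwScore {d : ℕ} (D : Experiment 𝒳 K Ω) (g : 𝒳 → ℝ → Vec d → Vec d)
    (a : Fin K) (T : ℕ) (θ : Vec d) (ω : Ω) : Vec d :=
  (1 / (T : ℝ)) • ∑ t ∈ Finset.range T,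
    ((1 / D.p t ω) * (if D.A t ω = a then 1 else 0)) • g (D.X t ω) (D.Yobs t ω) θ

/-- The approximate estimating equation `G_{a,T}(θ̂_a^{(T)}) = o_p(1/√T)` as `T → ∞`. -/
def SolvesIPW {d : ℕ} [MeasurableSpace Ω] (D : Experiment 𝒳 K Ω) (P : Measure Ω)
    (g : 𝒳 → ℝ → Vec d → Vec d) (a : Fin K) (θhat : ℕ → Ω → Vec d) : Prop :=
  TendstoInMeasure P (fun (T : ℕ) ω => √(T : ℝ) • D.ipwScore g a T (θhat T ω) ω) atTop
    (fun _ => (0 : Vec d))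

end Experiment

section Score

variable {dX K d : ℕ} {𝒳 : Set (Vec dX)}

/-- The law of `(X, Y(a))`. -/
noncomputable def armLaw (Q : Measure (𝒳 × (Fin K → ℝ))) (a : Fin K) : Measure (𝒳 × ℝ) :=
  Q.map (fun z => (z.1, z.2 a))

/-- Well-separated solution: for all `ε > 0`, `inf_{‖θ - θ*‖ > ε} ‖E g(X, Y; θ)‖ > 0`. The infimum
is taken in `[0, ∞]`. -/
def WellSeparated (ν : Measure (𝒳 × ℝ)) (g : 𝒳 → ℝ → Vec d → Vec d) (θstar : Vec d) : Prop :=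
  ∀ ε : ℝ, 0 < ε → 0 < ⨅ (θ : Vec d) (_ : ε < ‖θ - θstar‖), ‖∫ z, g z.1 z.2 θ ∂ν‖ₑ

/-- The matrix `E[g(X, Y; θ*) g(X, Y; θ*)ᵀ | X]`. -/
noncomputable def condSecondMoment (ν : Measure (𝒳 × ℝ)) (g : 𝒳 → ℝ → Vec d → Vec d)
    (θstar : Vec d) (z : 𝒳 × ℝ) : Matrix (Fin d) (Fin d) ℝ :=
  Matrix.of fun i j =>
    (ν[fun w => g w.1 w.2 θstar i * g w.1 w.2 θstar j |
      MeasurableSpace.comap Prod.fst inferInstance]) z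

/-- Bounded moments. The norm of the conditional second moment matrix is the spectral norm. -/
structure BoundedMoments (ν : Measure (𝒳 × ℝ)) (g : 𝒳 → ℝ → Vec d → Vec d) (θstar : Vec d)
    (R : ℝ) : Prop where
  cond_second : ∃ M₂ : ℝ, ∀ᵐ z ∂ν,
    ‖Matrix.toEuclideanCLM (𝕜 := ℝ) (condSecondMoment ν g θstar z)‖ ≤ M₂
  norm_lt : ‖θstar‖ < R
  second : ⨆ (θ : Vec d) (_ : ‖θ‖ ≤ R), ∫⁻ z, ‖g z.1 z.2 θ‖ₑ ^ 2 ∂ν < ∞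
  fourth : ∫⁻ z, ‖g z.1 z.2 θstar‖ₑ ^ 4 ∂ν < ∞

/-- The expected Jacobian `J = E ∇g(X, Y; θ*)`, with entries `J i j = E ∂g⁽ⁱ⁾/∂θ_j`. -/
noncomputable def meanJacobian (ν : Measure (𝒳 × ℝ)) (g : 𝒳 → ℝ → Vec d → Vec d)
    (θstar : Vec d) : Matrix (Fin d) (Fin d) ℝ :=
  Matrix.of fun i j => ∫ z, (fderiv ℝ (g z.1 z.2) θstar (EuclideanSpace.single j 1)) i ∂ν

/-- Smoothness of the score function. -/
structure SmoothScore (ν : Measure (𝒳 × ℝ)) (g : 𝒳 → ℝ → Vec d → Vec d) (θstar : Vec d)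
    (R : ℝ) : Prop where
  /-- `g(x, y; ·)` is twice differentiable -/
  differentiable : ∀ x y, Differentiable ℝ (g x y) ∧ Differentiable ℝ (fderiv ℝ (g x y))
  nonsingular : IsUnit (meanJacobian ν g θstar)
  first_deriv : ∃ φ : 𝒳 → ℝ → ℝ,
    (∀ x y θ, ‖θ‖ ≤ R → ‖fderiv ℝ (g x y) θ‖ ≤ φ x y) ∧ MemLp (fun z => φ z.1 z.2) 2 ν
  /-- the norm of the Hessian of the `i`-th entry is the spectral norm -/
  second_deriv : ∃ ε₀ : ℝ, 0 < ε₀ ∧ ∃ Φ : 𝒳 → ℝ → ℝ,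
    (∀ x y θ, ‖θ - θstar‖ ≤ ε₀ → ∀ i : Fin d,
      ‖fderiv ℝ (fderiv ℝ (fun η : Vec d => g x y η i)) θ‖ ≤ Φ x y) ∧
    Integrable (fun z => Φ z.1 z.2) ν

/-- The matrix `Ī_a = E[(1 / πbar(a | X)) g(X, Y(a); θ*) g(X, Y(a); θ*)ᵀ]`, where `ν` is the law
of `(X, Y(a))`. -/
noncomputable def ipwSecondMoment (ν : Measure (𝒳 × ℝ)) (g : 𝒳 → ℝ → Vec d → Vec d)
    (θstar : Vec d) (πbar : Kernel 𝒳 (Fin K)) (a : Fin K) : Matrix (Fin d) (Fin d) ℝ :=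
  Matrix.of fun i j =>
    ∫ z, (1 / (πbar z.1).real {a}) * (g z.1 z.2 θstar i * g z.1 z.2 θstar j) ∂ν

/-- The asymptotic covariance `Σ_a* = J_a⁻¹ Ī_a (J_a⁻¹)ᵀ` of the arm `a`. -/
noncomputable def asympCov (ν : Measure (𝒳 × ℝ)) (g : 𝒳 → ℝ → Vec d → Vec d)
    (θstar : Vec d) (πbar : Kernel 𝒳 (Fin K)) (a : Fin K) : Matrix (Fin d) (Fin d) ℝ :=
  (meanJacobian ν g θstar)⁻¹ * ipwSecondMoment ν g θstar πbar a *
    ((meanJacobian ν g θstar)⁻¹)ᵀ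

/-- The stacked vector of the `K` vectors `θ_a`; the entry `(i, a)` is the `i`-th entry of `θ_a`. -/
noncomputable def stack (θ : Fin K → Vec d) : EuclideanSpace ℝ (Fin d × Fin K) :=
  WithLp.toLp 2 fun q => θ q.2 q.1

end Score

end AdaptiveInference

open AdaptiveInference

/-!
For each arm the weighted estimating function is a mean of the summands
`1{A_t = a} / π_t(A_t) • g(X_t, Y_t; θ)`. Unconfoundedness says that, on the event `A_t = a`, the
law of (history, context, potential outcomes) has density `π_t(a)` (`map_restrict_action`), so that the
weight removes the selection: given the history, a summand has the mean of `g(X, Y(a); θ)`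
(`integral_weight_mul_smul_hist`), and the centered summands are orthogonal
(`integral_sq_sum_weight_le`). This gives the weak law of large numbers and the `√T` rate for
weighted means.

*Consistency* (`tendstoInMeasure_sub_of_solves`). The weighted means of the envelope `φ` of the
Jacobian bound the Lipschitz constant of the estimating function on the ball of radius `R`, so the
law of large numbers on a finite net is uniform, and the well-separated root is approached.

*Linearization* (`tendstoInMeasure_linearization`). A second-order Taylor expansion, with the
Hessian envelope `Φ`, and the law of large numbers for the Jacobian at the true parameter give
`√T (θ̂ - θ*) + J⁻¹ √T G_T(θ*) → 0` in probability.

*Central limit theorem* (`tendsto_integral_cexp_ipwMean`). Let `ξ_t` be the sum over the arms of the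
weighted values, at round `t`, of centered functions `f_a`. Against a bounded function of the
history, `exp(i u ξ_t)` may be replaced by `1 - u² σ² / 2` at the cost of `O(u³)` plus `u²` times
the expected distance of the conditional variance from its limit (`norm_integral_roundScore_le`), a
distance that vanishes as `t → ∞` because the policy converges. These estimates telescope over the
rounds, and with `u = 1 / √T` the accumulated error tends to zero by Cesàro averaging. At most one
arm is selected in a round, so that the second moment of `ξ_t` has no cross terms, which makes the
limiting covariance block-diagonal. Applied to the linear functionals of the stacked influence
functions `J_a⁻¹ g_a`, and combined with the linearization, this yields asymptotic normality
(`tendstoInDistribution_of_solves`).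

*Existence* (`exists_estimator`). Near minimizers of the norm of the estimating function over the
ball can be selected measurably in the data (`exists_near_minimizer`). The Newton step
`θ* - J⁻¹ G_T(θ*)` from the true parameter lies in the ball with probability tending to one and has
`G_T = o_p(1/√T)`, and a near minimizer does at least as well, up to `1/(T+1)`.
-/

namespace AdaptiveInference

/-! ### Convergence and boundedness in probability -/

section Stochastic

variable {Ω : Type*} [MeasurableSpace Ω] {P : Measure Ω}
  {E F : Type*} [SeminormedAddCommGroup E] [SeminormedAddCommGroup F]

lemma tendstoInMeasure_zero_iff {f : ℕ → Ω → E} :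
    TendstoInMeasure P f atTop (fun _ => (0 : E)) ↔
      ∀ ε : ℝ, 0 < ε → Tendsto (fun n => P {ω | ε ≤ ‖f n ω‖}) atTop (nhds 0) := by
  simp [tendstoInMeasure_iff_norm]

/-- A sequence that is dominated by a sequence tending to zero in probability, except on events
whose probability tends to zero, tends to zero in probability. -/
lemma tendstoInMeasure_zero_of_le_on {f : ℕ → Ω → E} {κ X : ℕ → Ω → ℝ} {δ : ℝ} (hδ : 0 < δ)
    (hκ : TendstoInMeasure P κ atTop (fun _ => (0 : ℝ)))
    (hX : TendstoInMeasure P X atTop (fun _ => (0 : ℝ)))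
    (h : ∀ᶠ n in atTop, ∀ᵐ ω ∂P, κ n ω < δ → ‖f n ω‖ ≤ X n ω) :
    TendstoInMeasure P f atTop (fun _ => (0 : E)) := by
  rw [tendstoInMeasure_zero_iff] at *
  intro ε hε
  have := (hκ δ hδ).add (hX ε hε)
  rw [add_zero] at this
  refine tendsto_of_tendsto_of_tendsto_of_le_of_le' tendsto_const_nhds this
    (Eventually.of_forall fun _ => zero_le) ?_
  filter_upwards [h] with n hn
  refine (measure_mono_ae ?_).trans (measure_union_le _ _)
  filter_upwards [hn] with ω hω hf
  by_cases hk : κ n ω < δ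
  · exact Or.inr ((le_trans hf (hω hk)).trans (Real.le_norm_self _))
  · exact Or.inl ((not_lt.1 hk).trans (Real.le_norm_self _))

lemma tendstoInMeasure_zero_const (P : Measure Ω) {x : ℕ → ℝ} (hx : Tendsto x atTop (nhds 0)) :
    TendstoInMeasure P (fun n _ => x n) atTop (fun _ => (0 : ℝ)) := by
  rw [tendstoInMeasure_zero_iff]
  intro ε hε
  refine tendsto_const_nhds.congr' ?_
  filter_upwards [hx.norm.eventually_lt_const (u := ε) (by simpa using hε)] with n hn
  have : {ω : Ω | ε ≤ ‖x n‖} = ∅ :=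
    Set.eq_empty_of_forall_notMem fun _ (h : ε ≤ ‖x n‖) => absurd hn (not_lt.2 h)
  rw [this, measure_empty]

lemma tendstoInMeasure_zero_of_le {f : ℕ → Ω → E} {X : ℕ → Ω → ℝ}
    (hX : TendstoInMeasure P X atTop (fun _ => (0 : ℝ)))
    (h : ∀ᶠ n in atTop, ∀ᵐ ω ∂P, ‖f n ω‖ ≤ X n ω) :
    TendstoInMeasure P f atTop (fun _ => (0 : E)) :=
  tendstoInMeasure_zero_of_le_on one_pos (tendstoInMeasure_zero_const P tendsto_const_nhds) hX
    (h.mono fun _ hn => hn.mono fun _ hω _ => hω)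

lemma tendstoInMeasure_zero_norm {f : ℕ → Ω → E}
    (hf : TendstoInMeasure P f atTop (fun _ => (0 : E))) :
    TendstoInMeasure P (fun n ω => ‖f n ω‖) atTop (fun _ => (0 : ℝ)) := by
  rw [tendstoInMeasure_zero_iff] at *
  simpa using hf

lemma tendstoInMeasure_zero_add {f g : ℕ → Ω → E}
    (hf : TendstoInMeasure P f atTop (fun _ => (0 : E)))
    (hg : TendstoInMeasure P g atTop (fun _ => (0 : E))) :
    TendstoInMeasure P (fun n ω => f n ω + g n ω) atTop (fun _ => (0 : E)) := by
  rw [tendstoInMeasure_zero_iff] at *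
  intro ε hε
  have := (hf (ε / 2) (half_pos hε)).add (hg (ε / 2) (half_pos hε))
  rw [add_zero] at this
  refine tendsto_of_tendsto_of_tendsto_of_le_of_le tendsto_const_nhds this
    (fun _ => zero_le) fun n => (measure_mono ?_).trans (measure_union_le _ _)
  intro ω (hω : ε ≤ ‖f n ω + g n ω‖)
  by_contra hc
  simp only [Set.mem_union, Set.mem_ofPred_eq, not_or, not_le] at hc
  linarith [norm_add_le (f n ω) (g n ω)]

lemma tendstoInMeasure_zero_sum {ι : Type*} (s : Finset ι) {f : ι → ℕ → Ω → E}
    (hf : ∀ i ∈ s, TendstoInMeasure P (f i) atTop (fun _ => (0 : E))) :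
    TendstoInMeasure P (fun n ω => ∑ i ∈ s, f i n ω) atTop (fun _ => (0 : E)) := by
  classical
  induction s using Finset.induction_on with
  | empty =>
    rw [tendstoInMeasure_zero_iff]
    intro ε hε
    simp [not_le.2 hε]
  | insert a s ha ih =>
    simp_rw [Finset.sum_insert ha]
    exact tendstoInMeasure_zero_add (hf a (Finset.mem_insert_self a s))
      (ih fun i hi => hf i (Finset.mem_insert_of_mem hi))

/-- Boundedness in probability, `Z_n = O_p(1)`. -/
def StochBounded (P : Measure Ω) (Z : ℕ → Ω → E) : Prop :=
  ∀ δ : ℝ≥0∞, 0 < δ → ∃ M : ℝ, 0 < M ∧ ∀ n, P {ω | M ≤ ‖Z n ω‖} ≤ δ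

/-- Markov's inequality. -/
lemma stochBounded_of_lintegral_le {Z : ℕ → Ω → E}
    (hZ : ∀ n, AEMeasurable (fun ω => ‖Z n ω‖ₑ) P) {C : ℝ≥0∞} (hC : C ≠ ∞) {k : ℕ} (hk : k ≠ 0)
    (h : ∀ n, ∫⁻ ω, ‖Z n ω‖ₑ ^ k ∂P ≤ C) : StochBounded P Z := by
  intro δ hδ
  obtain ⟨N, hN, hN1⟩ : ∃ N : ℕ, C / N ≤ δ ∧ 1 ≤ N := by
    have h1 : Tendsto (fun N : ℕ => C / (N : ℝ≥0∞)) atTop (nhds 0) := by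
      simpa [ENNReal.div_eq_inv_mul] using
        ENNReal.Tendsto.mul_const ENNReal.tendsto_inv_nat_nhds_zero (Or.inr hC) (b := C)
    exact ((h1.eventually_le_const hδ).and (eventually_ge_atTop 1)).exists
  refine ⟨N, by exact_mod_cast hN1, fun n => ?_⟩
  calc P {ω | (N : ℝ) ≤ ‖Z n ω‖} ≤ P {ω | (N : ℝ≥0∞) ≤ ‖Z n ω‖ₑ ^ k} := by
        refine measure_mono fun ω (hω : (N : ℝ) ≤ ‖Z n ω‖) => ?_
        have h1 : (N : ℝ≥0∞) ≤ ‖Z n ω‖ₑ := by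
          rw [← ofReal_norm, ← ENNReal.ofReal_natCast]
          exact ENNReal.ofReal_le_ofReal hω
        refine h1.trans (le_self_pow ?_ hk)
        exact le_trans (by exact_mod_cast hN1) h1
    _ ≤ (∫⁻ ω, ‖Z n ω‖ₑ ^ k ∂P) / N :=
        meas_ge_le_lintegral_div ((hZ n).pow_const k) (by exact_mod_cast (by omega))
          (ENNReal.natCast_ne_top N)
    _ ≤ C / N := by gcongr; exact h n
    _ ≤ δ := hN

lemma StochBounded.of_le {Z : ℕ → Ω → E} {W : ℕ → Ω → F} (hZ : StochBounded P Z)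
    (h : ∀ n ω, ‖W n ω‖ ≤ ‖Z n ω‖) : StochBounded P W := fun δ hδ => by
  obtain ⟨M, hM, hle⟩ := hZ δ hδ
  exact ⟨M, hM, fun n => (measure_mono fun ω (hω : M ≤ _) => hω.trans (h n ω)).trans (hle n)⟩

lemma stochBounded_const (P : Measure Ω) (x : E) : StochBounded P (fun (_ : ℕ) (_ : Ω) => x) :=
  fun δ _ => ⟨‖x‖ + 1, by positivity, fun n => by simp [show ¬ (1 : ℝ) ≤ 0 by norm_num]⟩

lemma StochBounded.add {Z W : ℕ → Ω → E} (hZ : StochBounded P Z) (hW : StochBounded P W) :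
    StochBounded P (fun n ω => Z n ω + W n ω) := by
  intro δ hδ
  obtain ⟨M, hM, h1⟩ := hZ (δ / 2) (ENNReal.half_pos hδ.ne')
  obtain ⟨M', hM', h2⟩ := hW (δ / 2) (ENNReal.half_pos hδ.ne')
  refine ⟨M + M', by positivity, fun n => ?_⟩
  rw [← ENNReal.add_halves δ]
  refine ((measure_mono ?_).trans (measure_union_le _ _)).trans (add_le_add (h1 n) (h2 n))
  intro ω (hω : M + M' ≤ ‖Z n ω + W n ω‖)
  by_contra hc
  simp only [Set.mem_union, Set.mem_ofPred_eq, not_or, not_le] at hc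
  linarith [norm_add_le (Z n ω) (W n ω)]

lemma StochBounded.sum {ι : Type*} (s : Finset ι) {Z : ι → ℕ → Ω → E}
    (hZ : ∀ i ∈ s, StochBounded P (Z i)) : StochBounded P (fun n ω => ∑ i ∈ s, Z i n ω) := by
  classical
  induction s using Finset.induction_on with
  | empty => simpa using stochBounded_const P (0 : E)
  | insert a s ha ih =>
    simp_rw [Finset.sum_insert ha]
    exact (hZ a (Finset.mem_insert_self a s)).add
      (ih fun i hi => hZ i (Finset.mem_insert_of_mem hi))

/-- `o_p(1) O_p(1) = o_p(1)`. -/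
lemma StochBounded.tendstoInMeasure_mul {κ : ℕ → Ω → ℝ} {Z : ℕ → Ω → ℝ}
    (hκ : TendstoInMeasure P κ atTop (fun _ => (0 : ℝ))) (hZ : StochBounded P Z) :
    TendstoInMeasure P (fun n ω => κ n ω * Z n ω) atTop (fun _ => (0 : ℝ)) := by
  rw [tendstoInMeasure_zero_iff] at *
  intro ε hε
  rw [ENNReal.tendsto_nhds_zero]
  intro δ hδ
  obtain ⟨M, hM, hle⟩ := hZ (δ / 2) (ENNReal.half_pos hδ.ne')
  filter_upwards [(hκ (ε / M) (by positivity)).eventually_le_const (ENNReal.half_pos hδ.ne')]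
    with n hn
  rw [← ENNReal.add_halves δ]
  refine ((measure_mono ?_).trans (measure_union_le _ _)).trans (add_le_add hn (hle n))
  intro ω (hω : ε ≤ ‖κ n ω * Z n ω‖)
  by_contra hc
  simp only [Set.mem_union, Set.mem_ofPred_eq, not_or, not_le] at hc
  rw [norm_mul] at hω
  have h1 : ‖κ n ω‖ * ‖Z n ω‖ < ε / M * M :=
    mul_lt_mul'' hc.1 hc.2 (norm_nonneg _) (norm_nonneg _)
  rw [div_mul_cancel₀ _ hM.ne'] at h1
  linarith

/-- A sequence dominated, for every `η > 0`, by `η O_p(1) + o_p(1)` with the same `O_p(1)` term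
for all `η` tends to zero in probability. -/
lemma StochBounded.tendstoInMeasure_of_le {V : ℕ → Ω → E} {B : ℕ → Ω → ℝ} (hB : StochBounded P B)
    (h : ∀ η : ℝ, 0 < η → ∃ X : ℕ → Ω → ℝ, TendstoInMeasure P X atTop (fun _ => (0 : ℝ)) ∧
      ∀ n, ∀ᵐ ω ∂P, ‖V n ω‖ ≤ η * B n ω + X n ω) :
    TendstoInMeasure P V atTop (fun _ => (0 : E)) := by
  rw [tendstoInMeasure_zero_iff]
  intro ε hε
  rw [ENNReal.tendsto_nhds_zero]
  intro δ hδ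
  obtain ⟨M, hM, hle⟩ := hB (δ / 2) (ENNReal.half_pos hδ.ne')
  obtain ⟨X, hX, hVX⟩ := h (ε / (2 * M)) (by positivity)
  rw [tendstoInMeasure_zero_iff] at hX
  filter_upwards [(hX (ε / 2) (by positivity)).eventually_le_const (ENNReal.half_pos hδ.ne')]
    with n hn
  rw [← ENNReal.add_halves δ]
  refine ((measure_mono_ae ?_).trans (measure_union_le _ _)).trans (add_le_add (hle n) hn)
  filter_upwards [hVX n] with ω hω (hV : ε ≤ ‖V n ω‖)
  by_contra hc
  replace hc := not_or.1 hc
  simp only [Set.mem_ofPred_eq, not_le] at hc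
  have h1 : ε / (2 * M) * B n ω ≤ ε / (2 * M) * M := by
    gcongr
    exact (Real.le_norm_self _).trans hc.1.le
  have h2 : ε / (2 * M) * M = ε / 2 := by field_simp
  linarith [(Real.le_norm_self (X n ω)).trans_lt hc.2]

lemma tendstoInMeasure_zero_const_mul (c : ℝ) {f : ℕ → Ω → ℝ}
    (hf : TendstoInMeasure P f atTop (fun _ => (0 : ℝ))) :
    TendstoInMeasure P (fun n ω => c * f n ω) atTop (fun _ => (0 : ℝ)) := by
  simpa [mul_comm] using (stochBounded_const P c).tendstoInMeasure_mul hf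

lemma norm_le_sum_abs {ι : Type*} [Fintype ι] (v : EuclideanSpace ℝ ι) : ‖v‖ ≤ ∑ i, |v i| := by
  classical
  calc ‖v‖ = ‖∑ i, EuclideanSpace.single i (v i)‖ := by
        congr 1
        ext j
        simp
    _ ≤ ∑ i, ‖EuclideanSpace.single i (v i)‖ := norm_sum_le _ _
    _ = ∑ i, |v i| := by simp

/-- A sequence of vectors tends to zero in probability if its coordinates do. -/
lemma tendstoInMeasure_zero_of_coord {ι : Type*} [Fintype ι] {f : ℕ → Ω → EuclideanSpace ℝ ι}
    (hf : ∀ i, TendstoInMeasure P (fun n ω => f n ω i) atTop (fun _ => (0 : ℝ))) :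
    TendstoInMeasure P f atTop (fun _ => (0 : EuclideanSpace ℝ ι)) := by
  refine tendstoInMeasure_zero_of_le (tendstoInMeasure_zero_sum Finset.univ fun i _ =>
    tendstoInMeasure_zero_norm (hf i)) (Eventually.of_forall fun n => ae_of_all _ fun ω =>
    norm_le_sum_abs _)

end Stochastic

/-! ### Taylor bounds -/

lemma norm_exp_mul_I_sub_taylor_le (x : ℝ) :
    ‖Complex.exp (x * Complex.I) - (1 + x * Complex.I - (x ^ 2 / 2 : ℝ))‖ ≤ 4 * |x| ^ 3 := by
  rcases le_or_gt |x| 1 with hx | hx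
  · have h := Complex.norm_exp_sub_sum_le_norm_mul_exp (x * Complex.I) 3
    have h1 : ∑ m ∈ Finset.range 3, ((x : ℂ) * Complex.I) ^ m / (m.factorial : ℂ) =
        1 + x * Complex.I - (x ^ 2 / 2 : ℝ) := by
      simp [Finset.sum_range_succ, Nat.factorial, mul_pow]
      ring
    rw [h1] at h
    refine h.trans ?_
    have h2 : Real.exp ‖(x : ℂ) * Complex.I‖ ≤ 4 := by
      rw [norm_mul, Complex.norm_I, mul_one, Complex.norm_real, Real.norm_eq_abs]
      refine (Real.exp_le_exp.2 hx).trans (Real.exp_one_lt_d9.le.trans (by norm_num))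
    have h3 : ‖(x : ℂ) * Complex.I‖ = |x| := by simp
    rw [h3] at h2 ⊢
    nlinarith [pow_nonneg (abs_nonneg x) 3]
  · have h1 : ‖Complex.exp (x * Complex.I)‖ = 1 := Complex.norm_exp_ofReal_mul_I x
    have h2 : ‖(1 : ℂ) + x * Complex.I - (x ^ 2 / 2 : ℝ)‖ ≤ 1 + |x| + |x| ^ 2 / 2 := by
      refine (norm_sub_le _ _).trans (add_le_add ((norm_add_le _ _).trans (by simp)) ?_)
      rw [Complex.norm_real, Real.norm_eq_abs, abs_of_nonneg (by positivity), sq_abs]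
    refine (norm_sub_le _ _).trans ?_
    rw [h1]
    nlinarith [mul_pos (sub_pos.2 hx) (sub_pos.2 hx), pow_pos (zero_lt_one.trans hx) 3,
      mul_pos (mul_pos (sub_pos.2 hx) (sub_pos.2 hx)) (sub_pos.2 hx)]

/-- Second-order Taylor bound for a vector-valued map whose coordinates have Hessians bounded by
`C` on a ball. -/
lemma norm_sub_sub_fderiv_le {d : ℕ} {f : Vec d → Vec d} (hf : Differentiable ℝ f)
    (hf' : Differentiable ℝ (fderiv ℝ f)) {x₀ : Vec d} {ε C : ℝ}
    (hC : ∀ x, ‖x - x₀‖ ≤ ε → ∀ i : Fin d,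
      ‖fderiv ℝ (fderiv ℝ (fun y : Vec d => f y i)) x‖ ≤ C)
    {x : Vec d} (hx : ‖x - x₀‖ ≤ ε) :
    ‖f x - f x₀ - fderiv ℝ f x₀ (x - x₀)‖ ≤ d * C * ‖x - x₀‖ ^ 2 := by
  set r := ‖x - x₀‖
  have key : ∀ i : Fin d, |(f x - f x₀ - fderiv ℝ f x₀ (x - x₀)) i| ≤ C * r ^ 2 := by
    intro i
    let p : Vec d →L[ℝ] ℝ := EuclideanSpace.proj i
    have hfd : fderiv ℝ (fun y : Vec d => f y i) = fun y => p.comp (fderiv ℝ f y) := by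
      ext1 y
      exact (p.hasFDerivAt.comp y (hf y).hasFDerivAt).fderiv
    have hd1 : Differentiable ℝ (fun y : Vec d => f y i) := fun y =>
      (p.hasFDerivAt.comp y (hf y).hasFDerivAt).differentiableAt
    have hd2 : Differentiable ℝ (fderiv ℝ (fun y : Vec d => f y i)) := by
      rw [hfd]
      exact fun y => (differentiableAt_const _).clm_comp (hf' y)
    have hconv : Convex ℝ (Metric.closedBall x₀ r) := convex_closedBall x₀ r
    have hx0 : x₀ ∈ Metric.closedBall x₀ r := Metric.mem_closedBall_self (norm_nonneg _)
    have hxm : x ∈ Metric.closedBall x₀ r := by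
      rw [Metric.mem_closedBall, dist_eq_norm]
    have hC' : ∀ y ∈ Metric.closedBall x₀ r,
        ‖fderiv ℝ (fderiv ℝ (fun y : Vec d => f y i)) y‖ ≤ C := fun y hy => by
      rw [Metric.mem_closedBall, dist_eq_norm] at hy
      exact hC y (hy.trans hx) i
    have h1 : ∀ y ∈ Metric.closedBall x₀ r, ‖fderiv ℝ (fun y : Vec d => f y i) y -
        fderiv ℝ (fun y : Vec d => f y i) x₀‖ ≤ C * r := fun y hy => by
      have := Convex.norm_image_sub_le_of_norm_fderiv_le (𝕜 := ℝ)
        (fun z _ => hd2 z) hC' hconv hx0 hy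
      refine this.trans ?_
      rw [Metric.mem_closedBall, dist_eq_norm] at hy
      have : 0 ≤ C := le_trans (norm_nonneg (fderiv ℝ (fderiv ℝ (fun y : Vec d => f y i)) x₀))
        (hC' x₀ hx0)
      gcongr
    have h2 := Convex.norm_image_sub_le_of_norm_fderiv_le' (𝕜 := ℝ) (fun z _ => hd1 z) h1
      hconv hx0 hxm
    have h3 : f x i - f x₀ i - fderiv ℝ (fun y : Vec d => f y i) x₀ (x - x₀) =
        (f x - f x₀ - fderiv ℝ f x₀ (x - x₀)) i := by
      rw [hfd]
      rfl
    rw [← h3, ← Real.norm_eq_abs]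
    calc _ ≤ C * r * ‖x - x₀‖ := h2
      _ = C * r ^ 2 := by ring
  set v := f x - f x₀ - fderiv ℝ f x₀ (x - x₀)
  calc ‖v‖ ≤ ∑ i, |v i| := norm_le_sum_abs v
    _ ≤ ∑ _i : Fin d, C * r ^ 2 := Finset.sum_le_sum fun i _ => key i
    _ = d * C * r ^ 2 := by simp; ring

/-! ### Reweighting by inverse selection probabilities -/

namespace Experiment

variable {dX K : ℕ} {𝒳 : Set (Vec dX)} {Ω : Type*}

/-- The history before round `t`, the context and the potential outcomes of round `t`. -/
def state (D : Experiment 𝒳 K Ω) (t : ℕ) (ω : Ω) :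
    ((Fin t → Obs 𝒳 K) × 𝒳) × (Fin K → ℝ) := ((D.hist t ω, D.X t ω), D.Y t ω)

/-- The inverse-probability weight `1{A_t = a} / π_t(A_t)`. -/
noncomputable def weight (D : Experiment 𝒳 K Ω) (a : Fin K) (t : ℕ) (ω : Ω) : ℝ :=
  (1 / D.p t ω) * (if D.A t ω = a then 1 else 0)

/-- The inverse-probability-weighted mean `(1/T) ∑_{t < T} 1{A_t = a} / π_t(A_t) • F(X_t, Y_t)`. -/
noncomputable def ipwMean {E : Type*} [AddCommGroup E] [Module ℝ E] (D : Experiment 𝒳 K Ω)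
    (a : Fin K) (F : 𝒳 × ℝ → E) (T : ℕ) (ω : Ω) : E :=
  (1 / (T : ℝ)) • ∑ t ∈ Finset.range T, D.weight a t ω • F (D.X t ω, D.Yobs t ω)

/-- The inverse-probability weight of the arm `a` as a function of a recorded round. -/
noncomputable def obsWeight (a : Fin K) (o : Obs 𝒳 K) : ℝ :=
  (1 / o.2.1) * (if o.2.2.1 = a then 1 else 0)

lemma measurable_obsWeight_smul (a : Fin K) {E : Type*} [NormedAddCommGroup E] [NormedSpace ℝ E]
    [MeasurableSpace E] [BorelSpace E] [SecondCountableTopology E] {f : 𝒳 × ℝ → E}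
    (hf : Measurable f) :
    Measurable (fun o : Obs 𝒳 K => obsWeight a o • f (o.1, o.2.2.2)) := by
  have hset : MeasurableSet {o : Obs 𝒳 K | o.2.2.1 = a} :=
    (measurable_fst.comp (measurable_snd.comp measurable_snd)) (measurableSet_singleton a)
  refine ((measurable_const.div (measurable_fst.comp measurable_snd)).mul
    (Measurable.ite hset measurable_const measurable_const)).smul (hf.comp ?_)
  fun_prop

section

variable {π : Policy 𝒳 K} {D : Experiment 𝒳 K Ω}

/-- Where the weight of the arm `a` does not vanish, the observed outcome is `Y_t(a)`. -/
lemma weight_smul_Yobs {E : Type*} [AddCommGroup E] [Module ℝ E] (a : Fin K) (t : ℕ) (ω : Ω)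
    (F : 𝒳 × ℝ → E) :
    D.weight a t ω • F (D.X t ω, D.Yobs t ω) = D.weight a t ω • F (D.X t ω, D.Y t ω a) := by
  by_cases h : D.A t ω = a
  · rw [Yobs, h]
  · simp [weight, h]

lemma ipwMean_apply {ι : Type*} [Fintype ι] (a : Fin K) (F : 𝒳 × ℝ → EuclideanSpace ℝ ι) (T : ℕ)
    (ω : Ω) (i : ι) : D.ipwMean a F T ω i = D.ipwMean a (fun z => F z i) T ω := by
  simp [ipwMean]

lemma ipwMean_sub {E : Type*} [AddCommGroup E] [Module ℝ E] (a : Fin K) (F G : 𝒳 × ℝ → E) (T : ℕ)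
    (ω : Ω) : D.ipwMean a (fun z => F z - G z) T ω = D.ipwMean a F T ω - D.ipwMean a G T ω := by
  simp [ipwMean, smul_sub]

lemma ipwMean_mul_const (a : Fin K) (f : 𝒳 × ℝ → ℝ) (r : ℝ) (T : ℕ) (ω : Ω) :
    D.ipwMean a (fun z => f z * r) T ω = D.ipwMean a f T ω * r := by
  simp only [ipwMean, smul_eq_mul, ← mul_assoc, ← Finset.sum_mul]

lemma ipwMean_clm_apply {E F : Type*} [NormedAddCommGroup E] [NormedSpace ℝ E]
    [NormedAddCommGroup F] [NormedSpace ℝ F] (a : Fin K) (f : 𝒳 × ℝ → E →L[ℝ] F) (T : ℕ) (ω : Ω)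
    (v : E) : D.ipwMean a f T ω v = D.ipwMean a (fun z => f z v) T ω := by
  simp [ipwMean]

lemma measurable_ipwMean {E : Type*} [NormedAddCommGroup E] [NormedSpace ℝ E]
    [MeasurableSpace E] [BorelSpace E] [SecondCountableTopology E] (a : Fin K) {F : 𝒳 × ℝ → E}
    (hF : Measurable F) (T : ℕ) : Measurable[D.histSigma T] (D.ipwMean a F T) := by
  have h : Measurable (fun h : Fin T → Obs 𝒳 K =>
      (1 / (T : ℝ)) • ∑ s, obsWeight a (h s) • F ((h s).1, (h s).2.2.2)) :=
    (Finset.measurable_sum _ fun s _ => (measurable_obsWeight_smul a hF).comp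
      (measurable_pi_apply (X := fun _ : Fin T => Obs 𝒳 K) s)).const_smul _
  have heq : D.ipwMean a F T = (fun h : Fin T → Obs 𝒳 K =>
      (1 / (T : ℝ)) • ∑ s, obsWeight a (h s) • F ((h s).1, (h s).2.2.2)) ∘ D.hist T := by
    ext1 ω
    simp only [ipwMean, Finset.sum_range]
    rfl
  rw [heq]
  exact h.comp (comap_measurable _)

lemma measurable_policy_real [∀ t, IsMarkovKernel (π t)] (t : ℕ) (a : Fin K) :
    Measurable (fun z => (π t z).real {a}) :=
  (Kernel.measurable_coe _ (measurableSet_singleton a)).ennreal_toReal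

lemma prob_nonneg (t : ℕ) (a : Fin K) (ω : Ω) : 0 ≤ D.prob π t a ω := measureReal_nonneg

lemma prob_le_one [∀ t, IsMarkovKernel (π t)] (t : ℕ) (a : Fin K) (ω : Ω) :
    D.prob π t a ω ≤ 1 := measureReal_le_one

end

variable [mΩ : MeasurableSpace Ω] {P : Measure Ω} {Q : Measure (𝒳 × (Fin K → ℝ))} {π : Policy 𝒳 K}
  {D : Experiment 𝒳 K Ω}

namespace IsGenerated

lemma weight_eq (hD : D.IsGenerated P Q π) (a : Fin K) (t : ℕ) (ω : Ω) :
    D.weight a t ω = (D.A t ⁻¹' {a}).indicator (fun ω => 1 / D.prob π t a ω) ω := by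
  by_cases h : D.A t ω = a
  · have : ω ∈ D.A t ⁻¹' {a} := h
    rw [Set.indicator_of_mem this, weight, hD.recorded, h]
    simp
  · have : ω ∉ D.A t ⁻¹' {a} := h
    rw [Set.indicator_of_notMem this, weight]
    simp [h]

lemma weight_nonneg (hD : D.IsGenerated P Q π) (a : Fin K) (t : ℕ) (ω : Ω) :
    0 ≤ D.weight a t ω := by
  rw [hD.weight_eq]
  exact Set.indicator_nonneg (fun ω _ => one_div_nonneg.2 (prob_nonneg t a ω)) ω

lemma norm_ipwMean_le (hD : D.IsGenerated P Q π) {E : Type*} [NormedAddCommGroup E]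
    [NormedSpace ℝ E] (a : Fin K) {F : 𝒳 × ℝ → E} {φ : 𝒳 × ℝ → ℝ} (h : ∀ z, ‖F z‖ ≤ φ z) (T : ℕ)
    (ω : Ω) : ‖D.ipwMean a F T ω‖ ≤ D.ipwMean a φ T ω := by
  rw [ipwMean, norm_smul, Real.norm_of_nonneg (by positivity : (0 : ℝ) ≤ 1 / T), ipwMean,
    smul_eq_mul]
  refine mul_le_mul_of_nonneg_left ((norm_sum_le _ _).trans
    (Finset.sum_le_sum fun t _ => ?_)) (by positivity)
  rw [norm_smul, Real.norm_of_nonneg (hD.weight_nonneg a t ω)]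
  exact mul_le_mul_of_nonneg_left (h _) (hD.weight_nonneg a t ω)

lemma ipwMean_nonneg (hD : D.IsGenerated P Q π) (a : Fin K) {φ : 𝒳 × ℝ → ℝ} (hφ : ∀ z, 0 ≤ φ z)
    (T : ℕ) (ω : Ω) : 0 ≤ D.ipwMean a φ T ω :=
  (norm_nonneg _).trans (hD.norm_ipwMean_le a (fun z => (Real.norm_of_nonneg (hφ z)).le) T ω)

lemma weight_le (hD : D.IsGenerated P Q π) {a : Fin K} {t : ℕ} {ω : Ω} {c : ℝ} (hc : 0 < c)
    (h : c ≤ D.prob π t a ω) : D.weight a t ω ≤ 1 / c := by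
  rw [hD.weight_eq]
  refine Set.indicator_apply_le' (fun _ => one_div_le_one_div_of_le hc h) fun _ => by positivity

lemma measurable_arm (hD : D.IsGenerated P Q π) (a : Fin K) (t : ℕ) :
    Measurable (fun ω => (D.X t ω, D.Y t ω a)) :=
  (hD.measurable_X t).prodMk ((measurable_pi_apply a).comp (hD.measurable_Y t))

lemma map_arm (hD : D.IsGenerated P Q π) (a : Fin K) (t : ℕ) :
    P.map (fun ω => (D.X t ω, D.Y t ω a)) = armLaw Q a := by
  have h : Measurable (fun z : 𝒳 × (Fin K → ℝ) => (z.1, z.2 a)) :=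
    measurable_fst.prodMk ((measurable_pi_apply a).comp measurable_snd)
  rw [armLaw, ← (hD.hasLaw t).map_eq,
    Measure.map_map h ((hD.measurable_X t).prodMk (hD.measurable_Y t))]
  rfl

lemma measurePreserving_arm (hD : D.IsGenerated P Q π) (a : Fin K) (t : ℕ) :
    MeasurePreserving (fun ω => (D.X t ω, D.Y t ω a)) P (armLaw Q a) :=
  ⟨hD.measurable_arm a t, hD.map_arm a t⟩

lemma measurableSet_action (hD : D.IsGenerated P Q π) (t : ℕ) (a : Fin K) :
    MeasurableSet (D.A t ⁻¹' {a}) := hD.measurable_A t (measurableSet_singleton a)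

lemma measurable_Yobs (hD : D.IsGenerated P Q π) (t : ℕ) : Measurable (D.Yobs t) := by
  have h : Measurable (fun z : (Fin K → ℝ) × Fin K => z.1 z.2) :=
    measurable_from_prod_countable_left fun a => measurable_pi_apply a
  exact h.comp ((hD.measurable_Y t).prodMk (hD.measurable_A t))

variable [∀ t, IsMarkovKernel (π t)]

lemma measurable_p_of_hist (hD : D.IsGenerated P Q π) {t : ℕ} (h : Measurable (D.hist t)) :
    Measurable (D.p t) := by
  have h1 : Measurable (fun z : ((Fin t → Obs 𝒳 K) × 𝒳) × Fin K => (π t z.1).real {z.2}) :=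
    measurable_from_prod_countable_left fun a => measurable_policy_real t a
  have h2 : D.p t = fun ω => (π t (D.hist t ω, D.X t ω)).real {D.A t ω} :=
    funext fun ω => hD.recorded t ω
  rw [h2]
  exact h1.comp ((h.prodMk (hD.measurable_X t)).prodMk (hD.measurable_A t))

/-- By induction, as the recorded probability of a round depends measurably on the past. -/
lemma measurable_hist (hD : D.IsGenerated P Q π) (t : ℕ) : Measurable (D.hist t) := by
  induction t using Nat.strong_induction_on with
  | _ t ih =>
    refine measurable_pi_lambda _ fun s => ?_
    exact (hD.measurable_X s).prodMk ((hD.measurable_p_of_hist (ih s s.2)).prodMk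
      ((hD.measurable_A s).prodMk (hD.measurable_Yobs s)))

lemma measurable_p (hD : D.IsGenerated P Q π) (t : ℕ) : Measurable (D.p t) :=
  hD.measurable_p_of_hist (hD.measurable_hist t)

lemma measurable_preAction (hD : D.IsGenerated P Q π) (t : ℕ) :
    Measurable (fun ω => (D.hist t ω, D.X t ω)) :=
  (hD.measurable_hist t).prodMk (hD.measurable_X t)

lemma measurable_prob (hD : D.IsGenerated P Q π) (t : ℕ) (a : Fin K) :
    Measurable (D.prob π t a) :=
  (measurable_policy_real t a).comp (hD.measurable_preAction t)

lemma measurable_state (hD : D.IsGenerated P Q π) (t : ℕ) : Measurable (D.state t) :=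
  (hD.measurable_preAction t).prodMk (hD.measurable_Y t)

lemma measurable_weight (hD : D.IsGenerated P Q π) (a : Fin K) (t : ℕ) :
    Measurable (D.weight a t) :=
  ((measurable_const.div (hD.measurable_p t))).mul
    (Measurable.ite (hD.measurableSet_action t a) measurable_const measurable_const)

/-- The fresh draw of round `t` is independent of the history. -/
lemma integral_smul_hist (hD : D.IsGenerated P Q π) {t : ℕ} {a : Fin K} {𝕜 : Type*} [RCLike 𝕜]
    {f : 𝒳 × ℝ → ℝ} (hf : Measurable f) {H : (Fin t → Obs 𝒳 K) → 𝕜} (hH : Measurable H) :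
    ∫ ω, f (D.X t ω, D.Y t ω a) • H (D.hist t ω) ∂P =
      (∫ z, f z ∂armLaw Q a) • ∫ ω, H (D.hist t ω) ∂P := by
  have hf' : Measurable (fun z : 𝒳 × (Fin K → ℝ) => ((f (z.1, z.2 a) : ℝ) : 𝕜)) :=
    RCLike.measurable_ofReal.comp (hf.comp
      (measurable_fst.prodMk ((measurable_pi_apply a).comp measurable_snd)))
  have hind := (hD.indep_hist t).comp hf' hH
  have h := hind.integral_fun_mul_eq_mul_integral
    (hf'.comp ((hD.measurable_X t).prodMk (hD.measurable_Y t))).aestronglyMeasurable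
    (hH.comp (hD.measurable_hist t)).aestronglyMeasurable
  simp only [Function.comp_apply] at h
  simp_rw [RCLike.real_smul_eq_coe_mul]
  rw [h, integral_ofReal, ← hD.map_arm a t, integral_map (hD.measurable_arm a t).aemeasurable
    hf.aestronglyMeasurable]

lemma measurable_weight_mul (hD : D.IsGenerated P Q π) (a : Fin K) (t : ℕ) {f : 𝒳 × ℝ → ℝ}
    (hf : Measurable f) : Measurable (fun ω => D.weight a t ω * f (D.X t ω, D.Yobs t ω)) :=
  (hD.measurable_weight a t).mul
    (hf.comp ((hD.measurable_X t).prodMk (hD.measurable_Yobs t)))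

lemma memLp_weight_mul (hD : D.IsGenerated P Q π) {a : Fin K} {t : ℕ} {c : ℝ} (hc : 0 < c)
    (hpos : ∀ᵐ ω ∂P, c ≤ D.prob π t a ω) {p : ℝ≥0∞} {f : 𝒳 × ℝ → ℝ} (hf : Measurable f)
    (hfp : MemLp f p (armLaw Q a)) :
    MemLp (fun ω => D.weight a t ω * f (D.X t ω, D.Yobs t ω)) p P := by
  refine ((hfp.comp_measurePreserving (hD.measurePreserving_arm a t)).const_mul (1 / c)).mono
    (hD.measurable_weight_mul a t hf).aestronglyMeasurable ?_
  filter_upwards [hpos] with ω hω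
  have := weight_smul_Yobs (D := D) a t ω f
  rw [smul_eq_mul, smul_eq_mul] at this
  rw [this, norm_mul, norm_mul, Real.norm_of_nonneg (hD.weight_nonneg a t ω),
    Real.norm_of_nonneg (one_div_pos.2 hc).le]
  exact mul_le_mul_of_nonneg_right (hD.weight_le hc hω) (norm_nonneg _)

lemma integral_weight_mul_pow_le (hD : D.IsGenerated P Q π) {a : Fin K} {t : ℕ} {c : ℝ}
    (hc : 0 < c) (hpos : ∀ᵐ ω ∂P, c ≤ D.prob π t a ω) {f : 𝒳 × ℝ → ℝ} (hf : Measurable f)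
    {k : ℕ} (hk : k ≠ 0) (hfk : MemLp f k (armLaw Q a)) :
    ∫ ω, |D.weight a t ω * f (D.X t ω, D.Yobs t ω)| ^ k ∂P ≤
      (1 / c) ^ k * ∫ z, |f z| ^ k ∂armLaw Q a := by
  have h1 := hfk.comp_measurePreserving (hD.measurePreserving_arm a t)
  rw [← hD.map_arm a t, integral_map (hD.measurable_arm a t).aemeasurable
    (hf.abs.pow_const k).aestronglyMeasurable, ← integral_const_mul]
  refine integral_mono_ae ((hD.memLp_weight_mul hc hpos hf hfk).integrable_norm_pow hk)
    ((h1.integrable_norm_pow hk).const_mul _) ?_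
  filter_upwards [hpos] with ω hω
  have := weight_smul_Yobs (D := D) a t ω f
  rw [smul_eq_mul, smul_eq_mul] at this
  simp only [this, abs_mul, mul_pow, abs_of_nonneg (hD.weight_nonneg a t ω)]
  exact mul_le_mul_of_nonneg_right (pow_le_pow_left₀ (hD.weight_nonneg a t ω)
    (hD.weight_le hc hω) k) (by positivity)

/-- Inverse-probability-weighted means of an integrable function are bounded in probability. -/
lemma stochBounded_ipwMean (hD : D.IsGenerated P Q π) {a : Fin K} {c : ℝ} (hc : 0 < c)
    (hpos : ∀ t, ∀ᵐ ω ∂P, c ≤ D.prob π t a ω) {φ : 𝒳 × ℝ → ℝ} (hφ : Integrable φ (armLaw Q a)) :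
    StochBounded P (D.ipwMean a φ) := by
  have hY : ∀ T, D.ipwMean a φ T =
      fun ω => (1 / (T : ℝ)) * ∑ t ∈ Finset.range T, D.weight a t ω * φ (D.X t ω, D.Y t ω a) := by
    intro T
    ext ω
    simp only [ipwMean, weight_smul_Yobs]
    rfl
  have hint : ∀ t, Integrable (fun ω => φ (D.X t ω, D.Y t ω a)) P := fun t =>
    (hD.measurePreserving_arm a t).integrable_comp_of_integrable hφ
  have hm : ∀ T, AEMeasurable (D.ipwMean a φ T) P := fun T => by
    rw [hY]
    exact (Finset.aemeasurable_fun_sum _ fun t _ => (hD.measurable_weight a t).aemeasurable.mul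
      (hint t).aemeasurable).const_mul _
  refine stochBounded_of_lintegral_le (fun T => (hm T).enorm)
    (C := ENNReal.ofReal (1 / c) * ∫⁻ z, ‖φ z‖ₑ ∂armLaw Q a)
    (ENNReal.mul_ne_top ENNReal.ofReal_ne_top hφ.2.ne) one_ne_zero fun T => ?_
  simp only [pow_one]
  have hb : ∀ᵐ ω ∂P, ‖D.ipwMean a φ T ω‖ₑ ≤ ENNReal.ofReal (1 / T) *
      ∑ t ∈ Finset.range T, ENNReal.ofReal (1 / c) * ‖φ (D.X t ω, D.Y t ω a)‖ₑ := by
    filter_upwards [ae_all_iff.2 hpos] with ω hω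
    rw [hY, enorm_mul, Real.enorm_of_nonneg (by positivity)]
    gcongr
    refine (enorm_sum_le _ _).trans (Finset.sum_le_sum fun t _ => ?_)
    rw [enorm_mul, Real.enorm_of_nonneg (hD.weight_nonneg a t ω)]
    gcongr
    exact hD.weight_le hc (hω t)
  refine (lintegral_mono_ae hb).trans ?_
  rw [lintegral_const_mul' _ _ ENNReal.ofReal_ne_top,
    lintegral_finsetSum' _ fun t _ => (hint t).aemeasurable.enorm.const_mul _]
  have hl : ∀ t, ∫⁻ ω, ENNReal.ofReal (1 / c) * ‖φ (D.X t ω, D.Y t ω a)‖ₑ ∂P =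
      ENNReal.ofReal (1 / c) * ∫⁻ z, ‖φ z‖ₑ ∂armLaw Q a := fun t => by
    have hφ' : AEMeasurable (fun z => ‖φ z‖ₑ) (P.map fun ω => (D.X t ω, D.Y t ω a)) := by
      rw [hD.map_arm]
      exact hφ.aemeasurable.enorm
    rw [lintegral_const_mul' _ _ ENNReal.ofReal_ne_top, ← hD.map_arm a t,
      lintegral_map' hφ' (hD.measurable_arm a t).aemeasurable]
  simp_rw [hl]
  rw [Finset.sum_const, Finset.card_range, nsmul_eq_mul, ← mul_assoc]
  refine mul_le_of_le_one_left (zero_le) ?_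
  rw [← ENNReal.ofReal_natCast, ← ENNReal.ofReal_mul (by positivity)]
  rw [ENNReal.ofReal_le_one]
  rcases Nat.eq_zero_or_pos T with rfl | hT
  · simp
  · rw [one_div_mul_cancel (by positivity)]

/-- On the event that the arm `a` is chosen, the law of (history, context, potential outcomes) has
density `π_t(a)` with respect to the unrestricted law. This combines unconfoundedness with the law
of the action. -/
lemma map_restrict_action [IsProbabilityMeasure P] (hD : D.IsGenerated P Q π)
    (hU : D.Unconfounded P) (t : ℕ) (a : Fin K) :
    (P.restrict (D.A t ⁻¹' {a})).map (D.state t) =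
      (P.withDensity fun ω => ENNReal.ofReal (D.prob π t a ω)).map (D.state t) := by
  have hS := hD.measurable_state t
  have hA := hD.measurableSet_action t a
  have : IsFiniteMeasure ((P.restrict (D.A t ⁻¹' {a})).map (D.state t)) :=
    Measure.isFiniteMeasure_map _ _
  refine Measure.ext_prod fun {B U} hB hU' => ?_
  have hm : D.preActionSigma t ≤ mΩ := (hD.measurable_preAction t).comap_le
  set B' := (fun ω => (D.hist t ω, D.X t ω)) ⁻¹' B
  set U' := D.Y t ⁻¹' U
  have hB'm : MeasurableSet[D.preActionSigma t] B' := ⟨B, hB, rfl⟩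
  have hB' : MeasurableSet B' := hm _ hB'm
  have hUm : MeasurableSet U' := hD.measurable_Y t hU'
  have hpre : D.state t ⁻¹' (B ×ˢ U) = B' ∩ U' := rfl
  rw [Measure.map_apply hS (hB.prod hU'), Measure.map_apply hS (hB.prod hU'), hpre,
    Measure.restrict_apply (hB'.inter hUm), withDensity_apply _ (hB'.inter hUm)]
  have hpi : Integrable (D.prob π t a) P :=
    Integrable.of_bound (hD.measurable_prob t a).aestronglyMeasurable 1
      (ae_of_all _ fun ω => by
        rw [Real.norm_of_nonneg (prob_nonneg t a ω)]; exact prob_le_one t a ω)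
  have hind : ∀ S : Set Ω, MeasurableSet S → Integrable (S.indicator fun _ => (1 : ℝ)) P :=
    fun S hS => (integrable_const (1 : ℝ)).indicator hS
  rw [← ofReal_integral_eq_lintegral_ofReal hpi.integrableOn
    (ae_of_all _ fun ω => prob_nonneg t a ω), ← ofReal_measureReal]
  congr 1
  have hpm : StronglyMeasurable[D.preActionSigma t] (D.prob π t a) := by
    refine Measurable.stronglyMeasurable ?_
    exact (measurable_policy_real t a).comp (comap_measurable _)
  have hprod : (fun ω => D.prob π t a ω) * U'.indicator (fun _ => (1 : ℝ)) =
      U'.indicator (D.prob π t a) := by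
    ext ω
    by_cases h : ω ∈ U' <;> simp [h]
  calc P.real (B' ∩ U' ∩ D.A t ⁻¹' {a})
      = ∫ ω in B', (D.A t ⁻¹' {a} ∩ U').indicator (fun _ => (1 : ℝ)) ω ∂P := by
        rw [setIntegral_indicator (hA.inter hUm), setIntegral_const, smul_eq_mul, mul_one,
          Set.inter_assoc, Set.inter_comm U']
    _ = ∫ ω in B', (P⟦D.A t ⁻¹' {a} ∩ U' | D.preActionSigma t⟧) ω ∂P :=
        (setIntegral_condExp hm (hind _ (hA.inter hUm)) hB'm).symm
    _ = ∫ ω in B', (P[U'.indicator (D.prob π t a) | D.preActionSigma t]) ω ∂P := by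
        refine setIntegral_congr_ae hB' ?_
        have h1 := hU t {a} U (measurableSet_singleton a) hU'
        have h2 := hD.action_law t a
        have h3 := condExp_mul_of_stronglyMeasurable_left hpm
          (by rw [hprod]; exact hpi.indicator hUm) (hind U' hUm)
        rw [hprod] at h3
        filter_upwards [h1, h2, h3] with ω h1 h2 h3 _
        rw [h1, h3, h2]
        rfl
    _ = ∫ ω in B', U'.indicator (D.prob π t a) ω ∂P :=
        setIntegral_condExp hm (hpi.indicator hUm) hB'm
    _ = ∫ ω in B' ∩ U', D.prob π t a ω ∂P := setIntegral_indicator hUm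

variable [IsProbabilityMeasure P]

lemma integral_action (hD : D.IsGenerated P Q π) (hU : D.Unconfounded P) (t : ℕ) (a : Fin K)
    {E : Type*} [NormedAddCommGroup E] [NormedSpace ℝ E]
    {F : ((Fin t → Obs 𝒳 K) × 𝒳) × (Fin K → ℝ) → E} (hF : StronglyMeasurable F) :
    ∫ ω in D.A t ⁻¹' {a}, F (D.state t ω) ∂P = ∫ ω, D.prob π t a ω • F (D.state t ω) ∂P := by
  rw [← integral_map (hD.measurable_state t).aemeasurable hF.aestronglyMeasurable,
    hD.map_restrict_action hU,
    integral_map (hD.measurable_state t).aemeasurable hF.aestronglyMeasurable,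
    integral_withDensity_eq_integral_toReal_smul (hD.measurable_prob t a).ennreal_ofReal
      (ae_of_all _ fun _ => ENNReal.ofReal_lt_top)]
  simp_rw [ENNReal.toReal_ofReal (prob_nonneg t a _)]

/-- Inverse-probability weighting removes the selection of the action. -/
lemma integral_weight_smul (hD : D.IsGenerated P Q π) (hU : D.Unconfounded P) {t : ℕ} {a : Fin K}
    (hpos : ∀ᵐ ω ∂P, 0 < D.prob π t a ω) {E : Type*} [NormedAddCommGroup E] [NormedSpace ℝ E]
    {F : ((Fin t → Obs 𝒳 K) × 𝒳) × (Fin K → ℝ) → E} (hF : StronglyMeasurable F) :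
    ∫ ω, D.weight a t ω • F (D.state t ω) ∂P = ∫ ω, F (D.state t ω) ∂P := by
  have h1 : (fun ω => D.weight a t ω • F (D.state t ω)) = (D.A t ⁻¹' {a}).indicator
      (fun ω => (fun s => (1 / (π t s.1).real {a}) • F s) (D.state t ω)) := by
    ext ω
    rw [hD.weight_eq, Set.indicator_smul_apply_left]
    rfl
  have hm : Measurable
      (fun s : ((Fin t → Obs 𝒳 K) × 𝒳) × (Fin K → ℝ) => 1 / (π t s.1).real {a}) :=
    measurable_const.div ((measurable_policy_real t a).comp measurable_fst)
  rw [h1, integral_indicator (hD.measurableSet_action t a),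
    hD.integral_action hU t a (F := fun s => (1 / (π t s.1).real {a}) • F s)
      (hm.stronglyMeasurable.smul hF)]
  refine integral_congr_ae ?_
  filter_upwards [hpos] with ω hω
  change D.prob π t a ω • (1 / D.prob π t a ω) • F (D.state t ω) = _
  rw [smul_smul, mul_one_div_cancel hω.ne', one_smul]

/-- A squared weight leaves one inverse selection probability behind. -/
lemma integral_weight_sq_smul (hD : D.IsGenerated P Q π) (hU : D.Unconfounded P) {t : ℕ}
    {a : Fin K} (hpos : ∀ᵐ ω ∂P, 0 < D.prob π t a ω) {E : Type*} [NormedAddCommGroup E]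
    [NormedSpace ℝ E] {F : ((Fin t → Obs 𝒳 K) × 𝒳) × (Fin K → ℝ) → E} (hF : StronglyMeasurable F) :
    ∫ ω, D.weight a t ω ^ 2 • F (D.state t ω) ∂P =
      ∫ ω, (1 / D.prob π t a ω) • F (D.state t ω) ∂P := by
  have hm : Measurable
      (fun s : ((Fin t → Obs 𝒳 K) × 𝒳) × (Fin K → ℝ) => 1 / (π t s.1).real {a}) :=
    measurable_const.div ((measurable_policy_real t a).comp measurable_fst)
  refine Eq.trans ?_ (hD.integral_weight_smul hU hpos (hm.stronglyMeasurable.smul hF))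
  congr 1
  ext ω
  change _ = D.weight a t ω • (1 / D.prob π t a ω) • F (D.state t ω)
  rw [smul_smul, sq]
  congr 1
  rw [hD.weight_eq]
  by_cases h : ω ∈ D.A t ⁻¹' {a} <;> simp [h]

/-- Given the history, the weighted value of `f` has the mean of `f(X, Y(a))`. -/
lemma integral_weight_mul_smul_hist (hD : D.IsGenerated P Q π) (hU : D.Unconfounded P) {t : ℕ}
    {a : Fin K} (hpos : ∀ᵐ ω ∂P, 0 < D.prob π t a ω) {𝕜 : Type*} [RCLike 𝕜]
    {f : 𝒳 × ℝ → ℝ} (hf : Measurable f) {H : (Fin t → Obs 𝒳 K) → 𝕜} (hH : Measurable H) :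
    ∫ ω, (D.weight a t ω * f (D.X t ω, D.Yobs t ω)) • H (D.hist t ω) ∂P =
      (∫ z, f z ∂armLaw Q a) • ∫ ω, H (D.hist t ω) ∂P := by
  rw [← hD.integral_smul_hist hf hH]
  have hF : Measurable (fun s : ((Fin t → Obs 𝒳 K) × 𝒳) × (Fin K → ℝ) =>
      f (s.1.2, s.2 a) • H s.1.1) := by
    refine Measurable.smul (hf.comp ?_) (hH.comp ?_)
    · exact (measurable_snd.comp measurable_fst).prodMk
        ((measurable_pi_apply a).comp measurable_snd)
    · exact measurable_fst.comp measurable_fst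
  refine Eq.trans ?_ (hD.integral_weight_smul hU hpos hF.stronglyMeasurable)
  congr 1
  ext ω
  have := weight_smul_Yobs (D := D) a t ω f
  rw [smul_eq_mul, smul_eq_mul] at this
  rw [this, mul_smul]
  rfl

/-- The centered weighted summands are orthogonal, so that the variance of their sum grows at most
linearly. -/
lemma integral_sq_sum_weight_le (hD : D.IsGenerated P Q π) (hU : D.Unconfounded P) {a : Fin K}
    {c : ℝ} (hc : 0 < c) (hpos : ∀ t, ∀ᵐ ω ∂P, c ≤ D.prob π t a ω) {f : 𝒳 × ℝ → ℝ}
    (hf : Measurable f) (hf2 : MemLp f 2 (armLaw Q a)) (T : ℕ) :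
    MemLp (fun ω => ∑ t ∈ Finset.range T, (D.weight a t ω * f (D.X t ω, D.Yobs t ω) -
      ∫ z, f z ∂armLaw Q a)) 2 P ∧
    ∫ ω, (∑ t ∈ Finset.range T, (D.weight a t ω * f (D.X t ω, D.Yobs t ω) -
      ∫ z, f z ∂armLaw Q a)) ^ 2 ∂P ≤
      T * (2 * ((1 / c) ^ 2 * ∫ z, f z ^ 2 ∂armLaw Q a) + 2 * (∫ z, f z ∂armLaw Q a) ^ 2) := by
  set m := ∫ z, f z ∂armLaw Q a
  set W : ℕ → Ω → ℝ := fun t ω => D.weight a t ω * f (D.X t ω, D.Yobs t ω)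
  set S : ℕ → Ω → ℝ := fun T ω => ∑ t ∈ Finset.range T, (W t ω - m)
  have hW : ∀ t, MemLp (W t) 2 P := fun t => hD.memLp_weight_mul hc (hpos t) hf hf2
  have hM : ∀ t, MemLp (fun ω => W t ω - m) 2 P := fun t => (hW t).sub (memLp_const m)
  have hS : ∀ T, MemLp (S T) 2 P := fun T => memLp_finsetSum _ fun t _ => hM t
  refine ⟨hS T, ?_⟩
  change ∫ ω, S T ω ^ 2 ∂P ≤ _
  induction T with
  | zero => simp [S]
  | succ T ih =>
    have hsucc : ∀ ω, S (T + 1) ω ^ 2 =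
        (S T ω ^ 2 + 2 * (W T ω * S T ω - m * S T ω)) + (W T ω - m) ^ 2 := fun ω => by
      simp only [S, Finset.sum_range_succ]
      ring
    have hWS : Integrable (fun ω => W T ω * S T ω) P := (hW T).integrable_mul (hS T)
    have hmS : Integrable (fun ω => m * S T ω) P :=
      ((hS T).integrable (by norm_num)).const_mul m
    -- the cross term vanishes since `S T` is a function of the history
    have hcross : ∫ ω, (W T ω * S T ω - m * S T ω) ∂P = 0 := by
      let H : (Fin T → Obs 𝒳 K) → ℝ := fun h => ∑ s : Fin T,
        (obsWeight a (h s) • f ((h s).1, (h s).2.2.2) - m)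
      have hH : Measurable H := by
        refine Finset.measurable_sum _ fun s _ => ?_
        exact ((measurable_obsWeight_smul a hf).sub_const m).comp
          (measurable_pi_apply (X := fun _ : Fin T => Obs 𝒳 K) s)
      have hHS : ∀ ω, H (D.hist T ω) = S T ω := fun ω => by
        simp only [S, Finset.sum_range]
        rfl
      have h := hD.integral_weight_mul_smul_hist hU
        ((hpos T).mono fun ω hω => hc.trans_le hω) hf hH
      simp only [hHS, smul_eq_mul] at h
      rw [integral_sub hWS hmS, integral_const_mul]
      exact sub_eq_zero.2 h
    have hsq : ∫ ω, (W T ω - m) ^ 2 ∂P ≤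
        2 * ((1 / c) ^ 2 * ∫ z, f z ^ 2 ∂armLaw Q a) + 2 * m ^ 2 := by
      calc ∫ ω, (W T ω - m) ^ 2 ∂P ≤ ∫ ω, (2 * W T ω ^ 2 + 2 * m ^ 2) ∂P := by
            refine integral_mono (hM T).integrable_sq
              (((hW T).integrable_sq.const_mul 2).add (integrable_const _)) fun ω => ?_
            change (W T ω - m) ^ 2 ≤ 2 * W T ω ^ 2 + 2 * m ^ 2
            nlinarith [sq_nonneg (W T ω + m)]
        _ = 2 * ∫ ω, W T ω ^ 2 ∂P + 2 * m ^ 2 := by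
            rw [integral_add ((hW T).integrable_sq.const_mul 2) (integrable_const _),
              integral_const_mul, integral_const, probReal_univ, one_smul]
        _ ≤ _ := by
            gcongr
            simpa only [sq_abs] using hD.integral_weight_mul_pow_le hc (hpos T) hf two_ne_zero hf2
    have h1 : Integrable (fun ω => S T ω ^ 2) P := (hS T).integrable_sq
    have h2 : Integrable (fun ω => 2 * (W T ω * S T ω - m * S T ω)) P :=
      (hWS.sub hmS).const_mul 2
    have h12 : Integrable (fun ω => S T ω ^ 2 + 2 * (W T ω * S T ω - m * S T ω)) P := h1.add h2
    simp_rw [hsucc]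
    rw [integral_add h12 (hM T).integrable_sq, integral_add h1 h2, integral_const_mul, hcross]
    push_cast
    linarith

/-- Weak law of large numbers for inverse-probability-weighted means of a square-integrable
function. -/
lemma tendstoInMeasure_ipwMean_sub (hD : D.IsGenerated P Q π) (hU : D.Unconfounded P) {a : Fin K}
    {c : ℝ} (hc : 0 < c) (hpos : ∀ t, ∀ᵐ ω ∂P, c ≤ D.prob π t a ω) {f : 𝒳 × ℝ → ℝ}
    (hf : Measurable f) (hf2 : MemLp f 2 (armLaw Q a)) :
    TendstoInMeasure P (fun T ω => D.ipwMean a f T ω - ∫ z, f z ∂armLaw Q a) atTop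
      (fun _ => (0 : ℝ)) := by
  set m := ∫ z, f z ∂armLaw Q a
  set C := 2 * ((1 / c) ^ 2 * ∫ z, f z ^ 2 ∂armLaw Q a) + 2 * m ^ 2
  rw [tendstoInMeasure_zero_iff]
  intro ε hε
  rw [← ENNReal.tendsto_toReal_zero_iff (fun _ => measure_ne_top _ _)]
  have hlim : Tendsto (fun T : ℕ => C / ε ^ 2 / (T : ℝ)) atTop (nhds 0) :=
    tendsto_const_div_atTop_nhds_zero_nat _
  refine tendsto_of_tendsto_of_tendsto_of_le_of_le' tendsto_const_nhds hlim
    (Eventually.of_forall fun _ => ENNReal.toReal_nonneg) ?_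
  filter_upwards [eventually_ge_atTop 1] with T hT
  have hT' : (0 : ℝ) < T := by exact_mod_cast hT
  obtain ⟨hS, hle⟩ := hD.integral_sq_sum_weight_le hU hc hpos hf hf2 T
  set S : Ω → ℝ := fun ω => ∑ t ∈ Finset.range T, (D.weight a t ω * f (D.X t ω, D.Yobs t ω) - m)
  have hSeq : ∀ ω, D.ipwMean a f T ω - m = S ω / T := fun ω => by
    simp only [S, ipwMean, smul_eq_mul, Finset.sum_sub_distrib, Finset.sum_const,
      Finset.card_range, nsmul_eq_mul]
    field_simp
  have hset : {ω | ε ≤ ‖D.ipwMean a f T ω - m‖} ⊆ {ω | (ε * T) ^ 2 ≤ S ω ^ 2} := by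
    intro ω (hω : ε ≤ ‖D.ipwMean a f T ω - m‖)
    rw [hSeq, norm_div, Real.norm_of_nonneg hT'.le, le_div_iff₀ hT'] at hω
    change (ε * T) ^ 2 ≤ S ω ^ 2
    rw [← sq_abs (S ω)]
    exact pow_le_pow_left₀ (by positivity) hω 2
  have hM := mul_meas_ge_le_integral_of_nonneg (ae_of_all P fun ω => sq_nonneg (S ω))
    hS.integrable_sq ((ε * T) ^ 2)
  have h1 : P.real {ω | ε ≤ ‖D.ipwMean a f T ω - m‖} ≤ P.real {ω | (ε * T) ^ 2 ≤ S ω ^ 2} :=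
    measureReal_mono hset
  change P.real _ ≤ _
  rw [div_div, le_div_iff₀ (by positivity)]
  have h2 : (ε * T) ^ 2 * P.real {ω | ε ≤ ‖D.ipwMean a f T ω - m‖} ≤ T * C :=
    (mul_le_mul_of_nonneg_left h1 (by positivity)).trans (hM.trans hle)
  have h3 : T * (P.real {ω | ε ≤ ‖D.ipwMean a f T ω - m‖} * (ε ^ 2 * T)) ≤ T * C := by
    nlinarith [h2]
  exact le_of_mul_le_mul_left h3 hT'

/-- Normalized inverse-probability-weighted means of a centered square-integrable function are
bounded in probability. -/
lemma stochBounded_sqrt_mul_ipwMean (hD : D.IsGenerated P Q π) (hU : D.Unconfounded P) {a : Fin K}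
    {c : ℝ} (hc : 0 < c) (hpos : ∀ t, ∀ᵐ ω ∂P, c ≤ D.prob π t a ω) {f : 𝒳 × ℝ → ℝ}
    (hf : Measurable f) (hf2 : MemLp f 2 (armLaw Q a)) (h0 : ∫ z, f z ∂armLaw Q a = 0) :
    StochBounded P (fun T ω => √(T : ℝ) * D.ipwMean a f T ω) := by
  set C := 2 * ((1 / c) ^ 2 * ∫ z, f z ^ 2 ∂armLaw Q a)
  have hS := hD.integral_sq_sum_weight_le hU hc hpos hf hf2
  simp only [h0, sub_zero, ne_eq, OfNat.ofNat_ne_zero, not_false_eq_true, zero_pow, mul_zero,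
    add_zero] at hS
  have heq : ∀ (T : ℕ) ω, √(T : ℝ) * D.ipwMean a f T ω = (√(T : ℝ) / T) *
      ∑ t ∈ Finset.range T, D.weight a t ω * f (D.X t ω, D.Yobs t ω) := fun T ω => by
    simp only [ipwMean, smul_eq_mul]
    ring
  have hm : ∀ T : ℕ, Measurable (fun ω => √(T : ℝ) * D.ipwMean a f T ω) := fun T => by
    simp_rw [heq]
    exact (Finset.measurable_sum _ fun t _ => hD.measurable_weight_mul a t hf).const_mul _
  refine stochBounded_of_lintegral_le (fun T => (hm T).enorm.aemeasurable)
    (C := ENNReal.ofReal C) ENNReal.ofReal_ne_top two_ne_zero fun T => ?_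
  have hsq : ∀ ω, ‖√(T : ℝ) * D.ipwMean a f T ω‖ₑ ^ 2 =
      ENNReal.ofReal ((√(T : ℝ) * D.ipwMean a f T ω) ^ 2) := fun ω => by
    rw [← enorm_pow, Real.enorm_of_nonneg (sq_nonneg _)]
  simp_rw [hsq, heq, mul_pow]
  rw [← ofReal_integral_eq_lintegral_ofReal ((hS T).1.integrable_sq.const_mul _)
    (ae_of_all _ fun ω => by positivity), integral_const_mul]
  refine ENNReal.ofReal_le_ofReal ?_
  refine (mul_le_mul_of_nonneg_left (hS T).2 (by positivity)).trans ?_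
  have hC : 0 ≤ C := by positivity
  rw [div_pow, Real.sq_sqrt (Nat.cast_nonneg T), ← mul_assoc]
  refine mul_le_of_le_one_left hC ?_
  rcases Nat.eq_zero_or_pos T with rfl | hT
  · simp
  · have : (0 : ℝ) < T := by exact_mod_cast hT
    field_simp
    exact le_refl _

end IsGenerated

end Experiment

/-! ### A central limit theorem for weighted sums -/

/-- Bounded convergence in probability against a weight with bounded second moments. -/
lemma tendsto_integral_abs_mul {Ω : Type*} [MeasurableSpace Ω] {P : Measure Ω}
    [IsProbabilityMeasure P] {V h : ℕ → Ω → ℝ} (hVm : ∀ n, Measurable (V n))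
    (hV1 : ∀ n ω, |V n ω| ≤ 1) (hV : TendstoInMeasure P V atTop (fun _ => (0 : ℝ)))
    (hh2 : ∀ n, MemLp (h n) 2 P) {B : ℝ} (hB : ∀ n, ∫ ω, h n ω ^ 2 ∂P ≤ B) :
    Tendsto (fun n => ∫ ω, |V n ω| * |h n ω| ∂P) atTop (nhds 0) := by
  have hB0 : 0 ≤ B := le_trans (integral_nonneg fun ω => sq_nonneg _) (hB 0)
  -- `|V| |h| ≤ V² / (2 η) + η h² / 2`, and `V² ≤ η² + 1{η² ≤ |V|}` as `|V| ≤ 1`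
  have key : ∀ η : ℝ, 0 < η → ∀ n, ∫ ω, |V n ω| * |h n ω| ∂P ≤
      η * (1 + B) / 2 + 1 / (2 * η) * P.real {ω | η ^ 2 ≤ ‖V n ω‖} := by
    intro η hη n
    have hS : MeasurableSet {ω | η ^ 2 ≤ ‖V n ω‖} :=
      measurableSet_le measurable_const (hVm n).norm
    have hi0 : Integrable (fun ω => 1 / (2 * η) *
        ({ω | η ^ 2 ≤ ‖V n ω‖}.indicator 1 ω : ℝ)) P :=
      ((integrable_const (1 : ℝ)).indicator hS).const_mul _
    have hi1 : Integrable (fun ω => η / 2 + 1 / (2 * η) *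
        ({ω | η ^ 2 ≤ ‖V n ω‖}.indicator 1 ω : ℝ)) P :=
      (integrable_const _).add hi0
    have hi2 : Integrable (fun ω => η / 2 * h n ω ^ 2) P := (hh2 n).integrable_sq.const_mul _
    have hle : ∀ ω, |V n ω| * |h n ω| ≤ (η / 2 + 1 / (2 * η) *
        ({ω | η ^ 2 ≤ ‖V n ω‖}.indicator 1 ω : ℝ)) + η / 2 * h n ω ^ 2 := by
      intro ω
      have h1 : |V n ω| * |h n ω| ≤ 1 / (2 * η) * |V n ω| ^ 2 + η / 2 * h n ω ^ 2 := by
        have : 0 ≤ 1 / (2 * η) * (|V n ω| - η * |h n ω|) ^ 2 := by positivity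
        have h2 : 1 / (2 * η) * (|V n ω| - η * |h n ω|) ^ 2 =
            1 / (2 * η) * |V n ω| ^ 2 - |V n ω| * |h n ω| + η / 2 * |h n ω| ^ 2 := by
          field_simp
          ring
        rw [h2, sq_abs (h n ω)] at this
        linarith
      have h3 : |V n ω| ^ 2 ≤ η ^ 2 + ({ω | η ^ 2 ≤ ‖V n ω‖}.indicator 1 ω : ℝ) := by
        have h4 : |V n ω| ^ 2 ≤ |V n ω| := by nlinarith [abs_nonneg (V n ω), hV1 n ω]
        by_cases hω : η ^ 2 ≤ ‖V n ω‖
        · rw [Set.indicator_of_mem (show ω ∈ {ω | η ^ 2 ≤ ‖V n ω‖} from hω)]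
          simp only [Pi.one_apply]
          nlinarith [hV1 n ω, sq_nonneg η]
        · rw [Set.indicator_of_notMem (show ω ∉ {ω | η ^ 2 ≤ ‖V n ω‖} from hω)]
          rw [Real.norm_eq_abs, not_le] at hω
          linarith
      have h5 : 1 / (2 * η) * |V n ω| ^ 2 ≤
          1 / (2 * η) * (η ^ 2 + ({ω | η ^ 2 ≤ ‖V n ω‖}.indicator 1 ω : ℝ)) := by gcongr
      have h6 : 1 / (2 * η) * η ^ 2 = η / 2 := by field_simp
      rw [mul_add, h6] at h5
      linarith
    have hint : Integrable (fun ω => |V n ω| * |h n ω|) P := by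
      refine Integrable.bdd_mul (c := 1) ((hh2 n).integrable (by norm_num)).abs
        (hVm n).abs.aestronglyMeasurable (ae_of_all _ fun ω => ?_)
      simpa using hV1 n ω
    refine (integral_mono hint (hi1.add hi2) hle).trans ?_
    rw [integral_add' hi1 hi2, integral_const_mul, integral_add (integrable_const _) hi0,
      integral_const_mul,
      integral_indicator_one hS, integral_const, probReal_univ, one_smul]
    nlinarith [hB n]
  have hnn : ∀ n, 0 ≤ ∫ ω, |V n ω| * |h n ω| ∂P := fun n =>
    integral_nonneg fun ω => by positivity
  rw [tendstoInMeasure_iff_measureReal_norm] at hV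
  simp only [sub_zero] at hV
  rw [Metric.tendsto_atTop']
  intro ε hε
  obtain ⟨η, hη, hηε⟩ : ∃ η : ℝ, 0 < η ∧ η * (1 + B) / 2 < ε :=
    ⟨ε / (1 + B), by positivity, by field_simp; norm_num⟩
  have hlim : Tendsto (fun n => η * (1 + B) / 2 + 1 / (2 * η) * P.real {ω | η ^ 2 ≤ ‖V n ω‖})
      atTop (nhds (η * (1 + B) / 2)) := by
    simpa using ((hV (η ^ 2) (by positivity)).const_mul (1 / (2 * η))).const_add (η * (1 + B) / 2)
  obtain ⟨N, hN⟩ := eventually_atTop.1 (hlim.eventually_lt_const hηε)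
  refine ⟨N, fun n hn => ?_⟩
  rw [Real.dist_eq, sub_zero, abs_of_nonneg (hnn n)]
  exact (key η hη n).trans_lt (hN n hn.le)

namespace Experiment

variable {dX K : ℕ} {𝒳 : Set (Vec dX)} {Ω : Type*}

/-- At most one of the weights of a round is nonzero. -/
lemma map_sum_weight_mul (D : Experiment 𝒳 K Ω) {φ : ℝ → ℝ} (hφ : φ 0 = 0) (t : ℕ) (ω : Ω)
    (x : Fin K → ℝ) : φ (∑ a, D.weight a t ω * x a) = ∑ a, φ (D.weight a t ω * x a) := by
  have h : ∀ b, b ≠ D.A t ω → D.weight b t ω * x b = 0 := fun b hb => by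
    simp [weight, hb.symm]
  rw [Finset.sum_eq_single (D.A t ω) (fun b _ hb => h b hb) (by simp),
    Finset.sum_eq_single (D.A t ω) (fun b _ hb => by rw [h b hb, hφ]) (by simp)]

/-- The total weighted score of round `t`. -/
noncomputable def roundScore (D : Experiment 𝒳 K Ω) (f : Fin K → 𝒳 × ℝ → ℝ) (t : ℕ) (ω : Ω) : ℝ :=
  ∑ a, D.weight a t ω * f a (D.X t ω, D.Yobs t ω)

/-- The asymptotic variance `∑_a E[f_a(X, Y(a))² / πbar(a | X)]`. -/
noncomputable def limitVar (Q : Measure (𝒳 × (Fin K → ℝ))) (πbar : Kernel 𝒳 (Fin K))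
    (f : Fin K → 𝒳 × ℝ → ℝ) : ℝ :=
  ∑ a, ∫ z, (1 / (πbar z.1).real {a}) * f a z ^ 2 ∂armLaw Q a

variable [mΩ : MeasurableSpace Ω] {P : Measure Ω} {Q : Measure (𝒳 × (Fin K → ℝ))} {π : Policy 𝒳 K}
  {D : Experiment 𝒳 K Ω} {πbar : Kernel 𝒳 (Fin K)}

namespace IsGenerated

lemma isProbabilityMeasure_armLaw [IsProbabilityMeasure P] (hD : D.IsGenerated P Q π) (a : Fin K) :
    IsProbabilityMeasure (armLaw Q a) := by
  rw [← hD.map_arm a 0]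
  exact Measure.isProbabilityMeasure_map (hD.measurable_arm a 0).aemeasurable

/-- The limiting policy inherits a lower bound from the behavior policy, since the contexts have the
same law in every round. -/
lemma policy_limit_ge (hD : D.IsGenerated P Q π) (hconv : D.PolicyConverges P π πbar) {a : Fin K}
    {c : ℝ} (hc : 0 < c) (hpos : ∀ t, ∀ᵐ ω ∂P, c ≤ D.prob π t a ω) :
    ∀ᵐ z ∂armLaw Q a, c / 2 ≤ (πbar z.1).real {a} := by
  have hm : Measurable (fun z : 𝒳 × ℝ => (πbar z.1).real {a}) :=
    (Kernel.measurable_coe πbar (measurableSet_singleton a)).ennreal_toReal.comp measurable_fst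
  have hN : MeasurableSet {z : 𝒳 × ℝ | (πbar z.1).real {a} < c / 2} :=
    measurableSet_lt hm measurable_const
  have hlim := tendstoInMeasure_zero_iff.1 (hconv a) (c / 2) (half_pos hc)
  have hle : ∀ t, armLaw Q a {z : 𝒳 × ℝ | (πbar z.1).real {a} < c / 2} ≤
      P {ω | c / 2 ≤ ‖D.prob π t a ω - (πbar (D.X t ω)).real {a}‖} := by
    intro t
    rw [← hD.map_arm a t, Measure.map_apply (hD.measurable_arm a t) hN]
    refine measure_mono_ae ?_
    filter_upwards [hpos t] with ω hω (h : (πbar (D.X t ω)).real {a} < c / 2)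
    change c / 2 ≤ ‖D.prob π t a ω - (πbar (D.X t ω)).real {a}‖
    exact le_trans (by linarith) (Real.le_norm_self _)
  have h0 : armLaw Q a {z : 𝒳 × ℝ | (πbar z.1).real {a} < c / 2} = 0 :=
    le_antisymm (ge_of_tendsto' hlim hle) zero_le
  rw [ae_iff]
  simpa only [not_le] using h0

lemma measurable_roundScore [∀ t, IsMarkovKernel (π t)] (hD : D.IsGenerated P Q π)
    {f : Fin K → 𝒳 × ℝ → ℝ}
    (hf : ∀ a, Measurable (f a)) (t : ℕ) : Measurable (D.roundScore f t) :=
  Finset.measurable_sum _ fun a _ => hD.measurable_weight_mul a t (hf a)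

variable [∀ t, IsMarkovKernel (π t)] [IsProbabilityMeasure P]

/-- The conditional variances of the weighted scores converge in mean. -/
lemma tendsto_integral_inv_prob_sub [IsMarkovKernel πbar] (hD : D.IsGenerated P Q π)
    (hconv : D.PolicyConverges P π πbar) {a : Fin K} {c : ℝ} (hc : 0 < c)
    (hpos : ∀ t, ∀ᵐ ω ∂P, c ≤ D.prob π t a ω) {f : 𝒳 × ℝ → ℝ} (hf : Measurable f)
    (hf4 : MemLp f 4 (armLaw Q a)) :
    Tendsto (fun t => ∫ ω, |1 / D.prob π t a ω - 1 / (πbar (D.X t ω)).real {a}| *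
      f (D.X t ω, D.Y t ω a) ^ 2 ∂P) atTop (nhds 0) := by
  have hm : Measurable (fun x : 𝒳 => (πbar x).real {a}) :=
    (Kernel.measurable_coe πbar (measurableSet_singleton a)).ennreal_toReal
  have hbar := hD.policy_limit_ge hconv hc hpos
  have hsq : MemLp (fun z => f z ^ 2) 2 (armLaw Q a) := by
    refine (memLp_two_iff_integrable_sq (hf.pow_const 2).aestronglyMeasurable).2 ?_
    refine (hf4.integrable_norm_pow (p := 4) (by norm_num)).congr (ae_of_all _ fun z => ?_)
    change |f z| ^ 4 = (f z ^ 2) ^ 2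
    rw [← sq_abs (f z), ← pow_mul]
  have hsq' : ∀ t, MemLp (fun ω => f (D.X t ω, D.Y t ω a) ^ 2) 2 P := fun t =>
    hsq.comp_measurePreserving (hD.measurePreserving_arm a t)
  have hVm : ∀ t, Measurable (fun ω => D.prob π t a ω - (πbar (D.X t ω)).real {a}) := fun t =>
    (hD.measurable_prob t a).sub (hm.comp (hD.measurable_X t))
  have hV1 : ∀ t ω, |D.prob π t a ω - (πbar (D.X t ω)).real {a}| ≤ 1 := fun t ω => by
    have h1 := prob_nonneg (D := D) (π := π) t a ω
    have h2 := prob_le_one (D := D) (π := π) t a ω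
    have h3 : 0 ≤ (πbar (D.X t ω)).real {a} := measureReal_nonneg
    have h4 : (πbar (D.X t ω)).real {a} ≤ 1 := measureReal_le_one
    rw [abs_le]
    constructor <;> linarith
  have hmain := tendsto_integral_abs_mul hVm hV1 (hconv a) hsq'
    (B := ∫ z, (f z ^ 2) ^ 2 ∂armLaw Q a) fun t => by
      rw [← hD.map_arm a t, integral_map (hD.measurable_arm a t).aemeasurable
        ((hf.pow_const 2).pow_const 2).aestronglyMeasurable]
  have hmain' := hmain.const_mul (2 / c ^ 2)
  rw [mul_zero] at hmain'
  refine squeeze_zero (fun t => integral_nonneg fun ω => by positivity) (fun t => ?_) hmain'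
  rw [← integral_const_mul]
  have hbart : ∀ᵐ ω ∂P, c / 2 ≤ (πbar (D.X t ω)).real {a} :=
    (hD.measurePreserving_arm a t).quasiMeasurePreserving.ae hbar
  refine integral_mono_of_nonneg (ae_of_all _ fun ω => by positivity) ?_ ?_
  · refine Integrable.const_mul ?_ _
    refine Integrable.bdd_mul (c := 1) ((hsq' t).integrable (by norm_num)).abs
      (hVm t).abs.aestronglyMeasurable (ae_of_all _ fun ω => ?_)
    simpa using hV1 t ω
  · filter_upwards [hpos t, hbart] with ω h1 h2
    have hp : 0 < D.prob π t a ω := hc.trans_le h1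
    have hb : 0 < (πbar (D.X t ω)).real {a} := (half_pos hc).trans_le h2
    rw [abs_of_nonneg (sq_nonneg (f (D.X t ω, D.Y t ω a))), ← mul_assoc]
    refine mul_le_mul_of_nonneg_right ?_ (sq_nonneg _)
    rw [div_sub_div _ _ hp.ne' hb.ne', one_mul, mul_one, abs_div, abs_sub_comm,
      abs_of_pos (mul_pos hp hb), div_eq_mul_inv, mul_comm]
    refine mul_le_mul_of_nonneg_right ?_ (abs_nonneg _)
    rw [inv_le_comm₀ (mul_pos hp hb) (by positivity)]
    calc (2 / c ^ 2)⁻¹ = c * (c / 2) := by field_simp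
      _ ≤ _ := mul_le_mul h1 h2 (half_pos hc).le hp.le

set_option maxHeartbeats 1000000 in
/-- One step of the characteristic-function recursion: against a bounded function `H` of the
history, `exp(i u ξ_t)` may be replaced by `1 - u² σ² / 2`, where `ξ_t` is the weighted score of
round `t` and `σ²` the limiting variance. -/
lemma norm_integral_roundScore_le (hD : D.IsGenerated P Q π) (hU : D.Unconfounded P)
    (hconv : D.PolicyConverges P π πbar) {c : Fin K → ℝ} (hc : ∀ a, 0 < c a)
    (hpos : ∀ a t, ∀ᵐ ω ∂P, c a ≤ D.prob π t a ω) {f : Fin K → 𝒳 × ℝ → ℝ}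
    (hf : ∀ a, Measurable (f a)) (hf4 : ∀ a, MemLp (f a) 4 (armLaw Q a))
    (h0 : ∀ a, ∫ z, f a z ∂armLaw Q a = 0) (u : ℝ) (t : ℕ) {H : (Fin t → Obs 𝒳 K) → ℂ}
    (hH : Measurable H) (hH1 : ∀ h, ‖H h‖ ≤ 1) :
    ‖∫ ω, (Complex.exp ((u * D.roundScore f t ω : ℝ) * Complex.I) -
        ((1 - u ^ 2 * limitVar Q πbar f / 2 : ℝ) : ℂ)) * H (D.hist t ω) ∂P‖ ≤
      u ^ 2 / 2 * (∑ a, ∫ ω, |1 / D.prob π t a ω - 1 / (πbar (D.X t ω)).real {a}| *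
        f a (D.X t ω, D.Y t ω a) ^ 2 ∂P) +
      4 * |u| ^ 3 * ∑ a, (1 / c a) ^ 3 * ∫ z, |f a z| ^ 3 ∂armLaw Q a := by
  have := fun a => hD.isProbabilityMeasure_armLaw a
  set ξ : Ω → ℝ := D.roundScore f t
  set G : Ω → ℂ := fun ω => H (D.hist t ω)
  have hGm : AEStronglyMeasurable G P := (hH.comp (hD.measurable_hist t)).aestronglyMeasurable
  have hG1 : ∀ ω, ‖G ω‖ ≤ 1 := fun ω => hH1 _
  have hsmul : ∀ {q : Ω → ℝ}, Integrable q P → Integrable (fun ω => q ω • G ω) P := fun hq =>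
    hq.smul_bdd 1 hGm (ae_of_all _ hG1)
  have hnorm : ∀ {q : Ω → ℝ}, Integrable q P → ‖∫ ω, q ω • G ω ∂P‖ ≤ ∫ ω, |q ω| ∂P := fun hq => by
    refine norm_integral_le_of_norm_le hq.abs (ae_of_all _ fun ω => ?_)
    rw [norm_smul, Real.norm_eq_abs]
    exact mul_le_of_le_one_right (abs_nonneg _) (hG1 ω)
  have hpos' : ∀ a, ∀ᵐ ω ∂P, 0 < D.prob π t a ω := fun a =>
    (hpos a t).mono fun ω hω => (hc a).trans_le hω
  -- integrability of the terms of the Taylor expansion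
  have hLp : ∀ a (k : ℕ), k ≤ 4 → MemLp (f a) k (armLaw Q a) := fun a k hk =>
    (hf4 a).mono_exponent (by exact_mod_cast hk)
  have hw : ∀ a (k : ℕ), k ≤ 4 →
      MemLp (fun ω => D.weight a t ω * f a (D.X t ω, D.Yobs t ω)) k P := fun a k hk =>
    hD.memLp_weight_mul (hc a) (hpos a t) (hf a) (hLp a k hk)
  have hξ : ∀ k : ℕ, k ≤ 4 → MemLp ξ k P := fun k hk => memLp_finsetSum _ fun a _ => hw a k hk
  have hξ1 : Integrable ξ P := memLp_one_iff_integrable.1 (by exact_mod_cast hξ 1 (by norm_num))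
  have hξ2 : Integrable (fun ω => ξ ω ^ 2) P := (hξ 2 (by norm_num)).integrable_sq
  have hξ3 : Integrable (fun ω => |ξ ω| ^ 3) P :=
    (hξ 3 (by norm_num)).integrable_norm_pow (by norm_num)
  have hξm : Measurable ξ := hD.measurable_roundScore hf t
  have hsqY : ∀ a, Integrable (fun ω => f a (D.X t ω, D.Y t ω a) ^ 2) P := fun a =>
    ((hLp a 2 (by norm_num)).comp_measurePreserving (hD.measurePreserving_arm a t)).integrable_sq
  have hprobY : ∀ a, Integrable
      (fun ω => (1 / D.prob π t a ω) * f a (D.X t ω, D.Y t ω a) ^ 2) P := fun a => by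
    refine (hsqY a).bdd_mul (c := 1 / c a)
      (measurable_const.div (hD.measurable_prob t a)).aestronglyMeasurable ?_
    filter_upwards [hpos a t] with ω hω
    rw [Real.norm_of_nonneg (one_div_nonneg.2 (prob_nonneg t a ω))]
    exact one_div_le_one_div_of_le (hc a) hω
  have hbarm : ∀ a, Measurable (fun x : 𝒳 => (πbar x).real {a}) := fun a =>
    (Kernel.measurable_coe πbar (measurableSet_singleton a)).ennreal_toReal
  have hbarY : ∀ a, Integrable
      (fun ω => (1 / (πbar (D.X t ω)).real {a}) * f a (D.X t ω, D.Y t ω a) ^ 2) P := fun a => by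
    refine (hsqY a).bdd_mul (c := 1 / (c a / 2))
      (measurable_const.div ((hbarm a).comp (hD.measurable_X t))).aestronglyMeasurable ?_
    filter_upwards [(hD.measurePreserving_arm a t).quasiMeasurePreserving.ae
      (hD.policy_limit_ge hconv (hc a) (hpos a))] with ω hω
    rw [Real.norm_of_nonneg (one_div_nonneg.2 measureReal_nonneg)]
    exact one_div_le_one_div_of_le (half_pos (hc a)) hω
  -- the first-order term vanishes
  have e1 : ∫ ω, ξ ω • G ω ∂P = 0 := by
    simp only [ξ, roundScore, Finset.sum_smul]
    rw [integral_finsetSum _ fun a _ => hsmul (memLp_one_iff_integrable.1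
      (by exact_mod_cast hw a 1 (by norm_num)))]
    refine Finset.sum_eq_zero fun a _ => ?_
    rw [hD.integral_weight_mul_smul_hist hU (hpos' a) (hf a) hH, h0 a, zero_smul]
  -- the second-order term is the conditional variance
  have e2 : ∫ ω, (ξ ω ^ 2) • G ω ∂P =
      ∑ a, ∫ ω, ((1 / D.prob π t a ω) * f a (D.X t ω, D.Y t ω a) ^ 2) • G ω ∂P := by
    have hsq : ∀ ω, ξ ω ^ 2 = ∑ a, (D.weight a t ω * f a (D.X t ω, D.Yobs t ω)) ^ 2 := fun ω =>
      map_sum_weight_mul D (φ := fun x => x ^ 2) (by norm_num) t ω _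
    simp only [hsq, Finset.sum_smul]
    rw [integral_finsetSum _ fun a _ => hsmul (hw a 2 (by norm_num)).integrable_sq]
    refine Finset.sum_congr rfl fun a _ => ?_
    have hF : Measurable (fun s : ((Fin t → Obs 𝒳 K) × 𝒳) × (Fin K → ℝ) =>
        (f a (s.1.2, s.2 a) ^ 2) • H s.1.1) := by
      refine Measurable.smul (((hf a).comp ?_).pow_const 2) (hH.comp ?_)
      · exact (measurable_snd.comp measurable_fst).prodMk
          ((measurable_pi_apply a).comp measurable_snd)
      · exact measurable_fst.comp measurable_fst
    have h := hD.integral_weight_sq_smul hU (hpos' a) hF.stronglyMeasurable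
    refine Eq.trans ?_ (h.trans ?_)
    · congr 1
      ext ω
      have := weight_smul_Yobs (D := D) a t ω (f a)
      rw [smul_eq_mul, smul_eq_mul] at this
      rw [this, mul_pow, mul_smul]
      rfl
    · congr 1
      ext ω
      rw [mul_smul]
      rfl
  have e3 : limitVar Q πbar f • ∫ ω, G ω ∂P =
      ∑ a, ∫ ω, ((1 / (πbar (D.X t ω)).real {a}) * f a (D.X t ω, D.Y t ω a) ^ 2) • G ω ∂P := by
    rw [limitVar, Finset.sum_smul]
    refine Finset.sum_congr rfl fun a _ => ?_
    exact (hD.integral_smul_hist (a := a)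
      (f := fun z => (1 / (πbar z.1).real {a}) * f a z ^ 2)
      ((measurable_const.div ((hbarm a).comp measurable_fst)).mul ((hf a).pow_const 2)) hH).symm
  -- Taylor expansion of the exponential
  set r : Ω → ℂ := fun ω => Complex.exp ((u * ξ ω : ℝ) * Complex.I) -
    (1 + (u * ξ ω : ℝ) * Complex.I - (((u * ξ ω) ^ 2 / 2 : ℝ) : ℂ))
  have hr : ∀ ω, ‖r ω * G ω‖ ≤ 4 * |u| ^ 3 * |ξ ω| ^ 3 := fun ω => by
    rw [norm_mul]
    refine (mul_le_of_le_one_right (norm_nonneg _) (hG1 ω)).trans ?_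
    refine (norm_exp_mul_I_sub_taylor_le (u * ξ ω)).trans (le_of_eq ?_)
    rw [abs_mul, mul_pow]
    ring
  have hrm : Measurable r := by
    have h1 : Measurable (fun ω => u * ξ ω) := hξm.const_mul u
    fun_prop
  have hrint : Integrable (fun ω => r ω * G ω) P :=
    (hξ3.const_mul (4 * |u| ^ 3)).mono' (hrm.aestronglyMeasurable.mul hGm) (ae_of_all _ hr)
  have hGint : Integrable G P := Integrable.of_bound hGm 1 (ae_of_all _ hG1)
  have hdec : ∀ ω, (Complex.exp ((u * ξ ω : ℝ) * Complex.I) -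
        ((1 - u ^ 2 * limitVar Q πbar f / 2 : ℝ) : ℂ)) * G ω =
      r ω * G ω + ((u * Complex.I) * (ξ ω • G ω) - ((u ^ 2 / 2 : ℝ) : ℂ) *
        ((ξ ω ^ 2) • G ω - limitVar Q πbar f • G ω)) := fun ω => by
    simp only [r, Complex.real_smul]
    push_cast
    ring
  have hvG : Integrable (fun ω => limitVar Q πbar f • G ω) P :=
    hsmul (integrable_const (limitVar Q πbar f))
  have hsub : ∫ ω, ((ξ ω ^ 2) • G ω - limitVar Q πbar f • G ω) ∂P =
      ∑ a, ∫ ω, ((1 / D.prob π t a ω - 1 / (πbar (D.X t ω)).real {a}) *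
        f a (D.X t ω, D.Y t ω a) ^ 2) • G ω ∂P := by
    rw [integral_sub (hsmul hξ2) hvG, integral_smul, e2, e3, ← Finset.sum_sub_distrib]
    refine Finset.sum_congr rfl fun a _ => ?_
    rw [← integral_sub (hsmul (hprobY a)) (hsmul (hbarY a))]
    simp_rw [sub_mul, sub_smul]
  have hi1 : Integrable (fun ω => (u * Complex.I) * (ξ ω • G ω)) P := (hsmul hξ1).const_mul _
  have hi2 : Integrable (fun ω => ((u ^ 2 / 2 : ℝ) : ℂ) *
      ((ξ ω ^ 2) • G ω - limitVar Q πbar f • G ω)) P :=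
    ((hsmul hξ2).sub hvG).const_mul _
  have hi12 : Integrable (fun ω => (u * Complex.I) * (ξ ω • G ω) - ((u ^ 2 / 2 : ℝ) : ℂ) *
      ((ξ ω ^ 2) • G ω - limitVar Q πbar f • G ω)) P := hi1.sub hi2
  refine (congrArg norm (integral_congr_ae (ae_of_all P hdec))).le.trans ?_
  rw [integral_add hrint hi12, integral_sub hi1 hi2, integral_const_mul, e1, mul_zero,
    zero_sub, integral_const_mul, hsub, add_comm]
  refine (norm_add_le _ _).trans (add_le_add ?_ ?_)
  · rw [norm_neg, norm_mul, Complex.norm_real, Real.norm_of_nonneg (by positivity)]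
    refine mul_le_mul_of_nonneg_left ((norm_sum_le _ _).trans
      (Finset.sum_le_sum fun a _ => ?_)) (by positivity)
    have hi : Integrable (fun ω => (1 / D.prob π t a ω - 1 / (πbar (D.X t ω)).real {a}) *
        f a (D.X t ω, D.Y t ω a) ^ 2) P := by
      simp_rw [sub_mul]
      exact (hprobY a).sub (hbarY a)
    refine (hnorm hi).trans (le_of_eq (integral_congr_ae (ae_of_all _ fun ω => ?_)))
    change |_ * _| = _
    rw [abs_mul, abs_sq]
  · refine (norm_integral_le_of_norm_le (hξ3.const_mul _) (ae_of_all _ hr)).trans ?_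
    rw [integral_const_mul]
    refine mul_le_mul_of_nonneg_left ?_ (by positivity)
    have hcube : ∀ ω, |ξ ω| ^ 3 = ∑ a, |D.weight a t ω * f a (D.X t ω, D.Yobs t ω)| ^ 3 :=
      fun ω => map_sum_weight_mul D (φ := fun x => |x| ^ 3) (by norm_num) t ω _
    simp_rw [hcube]
    have hi : ∀ a, Integrable
        (fun ω => |D.weight a t ω * f a (D.X t ω, D.Yobs t ω)| ^ 3) P := fun a =>
      (hw a 3 (by norm_num)).integrable_norm_pow (by norm_num)
    rw [integral_finsetSum _ fun a _ => hi a]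
    exact Finset.sum_le_sum fun a _ => hD.integral_weight_mul_pow_le (hc a) (hpos a t) (hf a)
      (by norm_num) (hLp a 3 (by norm_num))

/-- Central limit theorem, in terms of characteristic functions, for the sum over the arms of
normalized inverse-probability-weighted means of centered functions. Distinct arms contribute
independently to the limit, since no round has two arms. -/
lemma tendsto_integral_cexp_ipwMean [IsMarkovKernel πbar] (hD : D.IsGenerated P Q π)
    (hU : D.Unconfounded P)
    (hconv : D.PolicyConverges P π πbar) {c : Fin K → ℝ} (hc : ∀ a, 0 < c a)
    (hpos : ∀ a t, ∀ᵐ ω ∂P, c a ≤ D.prob π t a ω) {f : Fin K → 𝒳 × ℝ → ℝ}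
    (hf : ∀ a, Measurable (f a)) (hf4 : ∀ a, MemLp (f a) 4 (armLaw Q a))
    (h0 : ∀ a, ∫ z, f a z ∂armLaw Q a = 0) :
    Tendsto (fun T : ℕ => ∫ ω, Complex.exp
      ((√(T : ℝ) * ∑ a, D.ipwMean a (f a) T ω : ℝ) * Complex.I) ∂P) atTop
      (nhds (Complex.exp ((-(limitVar Q πbar f) / 2 : ℝ) : ℂ))) := by
  set v := limitVar Q πbar f
  have hv : 0 ≤ v := Finset.sum_nonneg fun a _ => integral_nonneg fun z =>
    mul_nonneg (one_div_nonneg.2 measureReal_nonneg) (sq_nonneg _)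
  set δ : ℕ → ℝ := fun t => ∑ a, ∫ ω, |1 / D.prob π t a ω - 1 / (πbar (D.X t ω)).real {a}| *
        f a (D.X t ω, D.Y t ω a) ^ 2 ∂P
  have hδ : Tendsto δ atTop (nhds 0) := by
    have := tendsto_finsetSum Finset.univ fun a _ =>
      hD.tendsto_integral_inv_prob_sub hconv (hc a) (hpos a) (hf a) (hf4 a)
    simpa only [Finset.sum_const_zero] using this
  set m := ∑ a, (1 / c a) ^ 3 * ∫ z, |f a z| ^ 3 ∂armLaw Q a
  set S : ℕ → Ω → ℝ := fun T ω => ∑ t ∈ Finset.range T, D.roundScore f t ω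
  have hSm : ∀ T, Measurable (S T) := fun T =>
    Finset.measurable_sum _ fun t _ => hD.measurable_roundScore hf t
  -- the one-step estimates telescope
  have htel : ∀ u : ℝ, |1 - u ^ 2 * v / 2| ≤ 1 → ∀ T : ℕ,
      ‖∫ ω, Complex.exp ((u * S T ω : ℝ) * Complex.I) ∂P - ((1 - u ^ 2 * v / 2 : ℝ) : ℂ) ^ T‖ ≤
        ∑ t ∈ Finset.range T, (u ^ 2 / 2 * δ t + 4 * |u| ^ 3 * m) := by
    intro u hu T
    induction T with
    | zero => simp [S]
    | succ T ih =>
      set q : ℂ := ((1 - u ^ 2 * v / 2 : ℝ) : ℂ)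
      let H : (Fin T → Obs 𝒳 K) → ℂ := fun h => Complex.exp ((u * ∑ s : Fin T, ∑ a,
        obsWeight a (h s) • f a ((h s).1, (h s).2.2.2) : ℝ) * Complex.I)
      have hHm : Measurable H := by
        have : Measurable (fun h : Fin T → Obs 𝒳 K => u * ∑ s : Fin T, ∑ a,
            obsWeight a (h s) • f a ((h s).1, (h s).2.2.2)) :=
          (Finset.measurable_sum _ fun s _ => Finset.measurable_sum _ fun a _ =>
            (measurable_obsWeight_smul a (hf a)).comp
              (measurable_pi_apply (X := fun _ : Fin T => Obs 𝒳 K) s)).const_mul u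
        fun_prop
      have hHS : ∀ ω, H (D.hist T ω) = Complex.exp ((u * S T ω : ℝ) * Complex.I) := fun ω => by
        simp only [S, Finset.sum_range]
        rfl
      have hstep := hD.norm_integral_roundScore_le hU hconv hc hpos hf hf4 h0 u T hHm
        fun h => (Complex.norm_exp_ofReal_mul_I _).le
      have hexp : ∀ T, Integrable (fun ω => Complex.exp ((u * S T ω : ℝ) * Complex.I)) P :=
        fun T => by
        have h1 : Measurable (fun ω => u * S T ω) := (hSm T).const_mul u
        refine Integrable.of_bound (Measurable.aestronglyMeasurable (by fun_prop)) 1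
          (ae_of_all _ fun ω => (Complex.norm_exp_ofReal_mul_I _).le)
      have hrec : ∫ ω, (Complex.exp ((u * D.roundScore f T ω : ℝ) * Complex.I) - q) *
          H (D.hist T ω) ∂P = ∫ ω, Complex.exp ((u * S (T + 1) ω : ℝ) * Complex.I) ∂P -
            q * ∫ ω, Complex.exp ((u * S T ω : ℝ) * Complex.I) ∂P := by
        rw [← integral_const_mul, ← integral_sub (hexp (T + 1)) ((hexp T).const_mul q)]
        congr 1
        ext ω
        rw [hHS, sub_mul, ← Complex.exp_add]
        congr 2
        simp only [S, Finset.sum_range_succ]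
        push_cast
        ring
      rw [hrec] at hstep
      have hq : ‖q‖ ≤ 1 := by rwa [Complex.norm_real]
      rw [Finset.sum_range_succ, pow_succ']
      set A := ∫ ω, Complex.exp ((u * S (T + 1) ω : ℝ) * Complex.I) ∂P
      set B := ∫ ω, Complex.exp ((u * S T ω : ℝ) * Complex.I) ∂P
      calc ‖A - q * q ^ T‖ = ‖q * (B - q ^ T) + (A - q * B)‖ := by congr 1; ring
        _ ≤ ‖q‖ * ‖B - q ^ T‖ + ‖A - q * B‖ := (norm_add_le _ _).trans (by rw [norm_mul])
        _ ≤ _ := add_le_add ((mul_le_of_le_one_left (norm_nonneg _) hq).trans ih) hstep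
  -- the accumulated error vanishes for `u = 1 / √T`
  have herr : Tendsto (fun T : ℕ => ∑ t ∈ Finset.range T,
      ((1 / √(T : ℝ)) ^ 2 / 2 * δ t + 4 * |1 / √(T : ℝ)| ^ 3 * m)) atTop (nhds 0) := by
    have h1 : Tendsto (fun T : ℕ => 1 / 2 * ((T : ℝ)⁻¹ * ∑ t ∈ Finset.range T, δ t) +
        4 * m * (√(T : ℝ))⁻¹) atTop (nhds (1 / 2 * 0 + 4 * m * 0)) :=
      (hδ.cesaro.const_mul _).add ((tendsto_inv_atTop_zero.comp (Real.tendsto_sqrt_atTop.comp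
        tendsto_natCast_atTop_atTop)).const_mul _)
    rw [mul_zero, mul_zero, add_zero] at h1
    refine h1.congr' ?_
    filter_upwards [eventually_ge_atTop 1] with T hT
    have hT' : (0 : ℝ) < T := by exact_mod_cast hT
    have hs : 0 < √(T : ℝ) := Real.sqrt_pos.2 hT'
    have hsq : √(T : ℝ) ^ 2 = T := Real.sq_sqrt hT'.le
    rw [Finset.sum_add_distrib, ← Finset.mul_sum, Finset.sum_const, Finset.card_range,
      nsmul_eq_mul, abs_of_pos (by positivity)]
    have h2 : (T : ℝ) * (4 * (1 / √(T : ℝ)) ^ 3 * m) = 4 * m * (√(T : ℝ))⁻¹ := by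
      field_simp
      rw [hsq]
    rw [h2, div_pow, one_pow, hsq]
    ring
  have hpow : Tendsto (fun T : ℕ => ((1 - (1 / √(T : ℝ)) ^ 2 * v / 2 : ℝ) : ℂ) ^ T) atTop
      (nhds (Complex.exp ((-v / 2 : ℝ) : ℂ))) := by
    refine (Complex.tendsto_one_add_div_pow_exp ((-v / 2 : ℝ) : ℂ)).congr fun T => ?_
    congr 1
    rw [div_pow, one_pow, Real.sq_sqrt (Nat.cast_nonneg T)]
    push_cast
    ring
  have hdiff : Tendsto (fun T : ℕ => ∫ ω, Complex.exp
      ((√(T : ℝ) * ∑ a, D.ipwMean a (f a) T ω : ℝ) * Complex.I) ∂P -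
      ((1 - (1 / √(T : ℝ)) ^ 2 * v / 2 : ℝ) : ℂ) ^ T) atTop (nhds 0) := by
    refine squeeze_zero_norm' ?_ herr
    filter_upwards [eventually_ge_atTop (max 1 ⌈v⌉₊)] with T hT
    have hT' : (0 : ℝ) < T := by exact_mod_cast (le_max_left _ _).trans hT
    have hvT : v ≤ T := (Nat.le_ceil v).trans (by exact_mod_cast (le_max_right _ _).trans hT)
    have hs : 0 < √(T : ℝ) := Real.sqrt_pos.2 hT'
    have hsq : √(T : ℝ) ^ 2 = T := Real.sq_sqrt hT'.le
    have hu : |1 - (1 / √(T : ℝ)) ^ 2 * v / 2| ≤ 1 := by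
      rw [div_pow, one_pow, hsq, abs_le]
      have h1 : 1 / (T : ℝ) * v ≤ 1 := by rw [one_div_mul_eq_div]; exact (div_le_one hT').2 hvT
      have h2 : 0 ≤ 1 / (T : ℝ) * v := by positivity
      constructor <;> linarith
    refine le_trans (le_of_eq ?_) (htel (1 / √(T : ℝ)) hu T)
    congr 4
    ext ω
    congr 3
    simp only [S, roundScore, ipwMean, smul_eq_mul]
    rw [Finset.sum_comm, ← Finset.mul_sum, ← mul_assoc]
    congr 1
    field_simp
    rw [hsq]
  simpa using hdiff.add hpow

end IsGenerated
end Experiment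

/-! ### Deterministic bounds and measurable selection -/

section Deterministic

variable {d : ℕ}

lemma opNorm_le_sum_single (L : Vec d →L[ℝ] Vec d) :
    ‖L‖ ≤ ∑ j, ‖L (EuclideanSpace.single j 1)‖ := by
  refine L.opNorm_le_bound (Finset.sum_nonneg fun _ _ => norm_nonneg _) fun v => ?_
  have hv : L v = ∑ j, v j • L (EuclideanSpace.single j 1) := by
    conv_lhs => rw [← (EuclideanSpace.basisFun (Fin d) ℝ).sum_repr v]
    simp
  rw [hv, Finset.sum_mul]
  refine (norm_sum_le _ _).trans (Finset.sum_le_sum fun j _ => ?_)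
  rw [norm_smul, mul_comm]
  exact mul_le_mul_of_nonneg_left (PiLp.norm_apply_le v j) (norm_nonneg _)

lemma norm_sub_le_of_norm_fderiv_le {f : Vec d → Vec d} (hf : Differentiable ℝ f) {R C : ℝ}
    (hC : ∀ x, ‖x‖ ≤ R → ‖fderiv ℝ f x‖ ≤ C) {x y : Vec d} (hx : ‖x‖ ≤ R) (hy : ‖y‖ ≤ R) :
    ‖f x - f y‖ ≤ C * ‖x - y‖ :=
  Convex.norm_image_sub_le_of_norm_fderiv_le (𝕜 := ℝ) (s := Metric.closedBall 0 R)
    (fun z _ => hf z) (fun z hz => hC z (mem_closedBall_zero_iff.1 hz)) (convex_closedBall 0 R)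
    (mem_closedBall_zero_iff.2 hy) (mem_closedBall_zero_iff.2 hx)

/-- If `G` is approximately affine, with slope `A` close to the invertible map `J`, then
`s (Δ + J⁻¹ G(θ*))` is small whenever `s G(θ* + Δ)` is. Here `Gs = G(θ*)` and
`Gh = G(θ* + Δ)`. -/
lemma norm_linearization_le {E : Type*} [NormedAddCommGroup E] [NormedSpace ℝ E]
    {J Jinv A : E →L[ℝ] E} (hJ : ∀ v, Jinv (J v) = v) {Gs Gh Δ : E} {B s : ℝ} (hB0 : 0 ≤ B)
    (hs : 0 ≤ s) (hB : ‖Gh - Gs - A Δ‖ ≤ B * ‖Δ‖ ^ 2)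
    (hκ : ‖Jinv‖ * (B * ‖Δ‖ + ‖A - J‖) ≤ 1 / 2) :
    ‖s • Δ + Jinv (s • Gs)‖ ≤ 2 * ‖Jinv‖ * ‖s • Gh‖ +
      2 * ‖Jinv‖ ^ 2 * ((B * ‖Δ‖ + ‖A - J‖) * ‖s • Gs‖) := by
  set c := ‖Jinv‖
  set κ := B * ‖Δ‖ + ‖A - J‖
  set r := s • Δ + Jinv (s • Gs)
  have hc : 0 ≤ c := norm_nonneg _
  have hU : ‖s • Δ‖ = s * ‖Δ‖ := by rw [norm_smul, Real.norm_of_nonneg hs]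
  have hrep : r = Jinv (s • Gh - s • (Gh - Gs - A Δ) - (A - J) (s • Δ)) := by
    have : s • Gh - s • (Gh - Gs - A Δ) - (A - J) (s • Δ) = J (s • Δ) + s • Gs := by
      simp only [_root_.sub_apply, map_smul, smul_sub]
      abel
    rw [this, map_add, hJ]
  have h1 : ‖r‖ ≤ c * (‖s • Gh‖ + κ * ‖s • Δ‖) := by
    rw [hrep]
    refine (Jinv.le_opNorm _).trans (mul_le_mul_of_nonneg_left ?_ hc)
    refine (norm_sub_le _ _).trans ((add_le_add (norm_sub_le _ _)
      ((A - J).le_opNorm _)).trans ?_)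
    have h2 : ‖s • (Gh - Gs - A Δ)‖ ≤ B * ‖Δ‖ * ‖s • Δ‖ := by
      rw [norm_smul, Real.norm_of_nonneg hs, hU]
      nlinarith [mul_le_mul_of_nonneg_left hB hs]
    simp only [κ]
    linarith
  have hκ0 : 0 ≤ κ := by positivity
  have h3 : ‖s • Δ‖ ≤ ‖r‖ + c * ‖s • Gs‖ := by
    have : s • Δ = r - Jinv (s • Gs) := by simp [r]
    rw [this]
    exact (norm_sub_le _ _).trans (add_le_add le_rfl (Jinv.le_opNorm _))
  have h4 : c * (κ * ‖s • Δ‖) ≤ c * (κ * (‖r‖ + c * ‖s • Gs‖)) := by gcongr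
  have h5 : c * κ * ‖r‖ ≤ 1 / 2 * ‖r‖ := mul_le_mul_of_nonneg_right hκ (norm_nonneg _)
  nlinarith

end Deterministic

lemma integral_coord {α : Type*} [MeasurableSpace α] {μ : Measure α} {F : α → Vec d}
    (hF : Integrable F μ) (i : Fin d) : (∫ z, F z ∂μ) i = ∫ z, F z i ∂μ :=
  ((EuclideanSpace.proj (𝕜 := ℝ) i).integral_comp_comm hF).symm

/-- Nearly minimal elements of a sequence of nonnegative functions can be selected measurably. -/
lemma exists_measurable_near_min {Ω : Type*} [MeasurableSpace Ω] {f : ℕ → Ω → ℝ}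
    (hf : ∀ n, Measurable (f n)) (h0 : ∀ n ω, 0 ≤ f n ω) {η : ℝ} (hη : 0 < η) :
    ∃ N : Ω → ℕ, Measurable N ∧ ∀ ω k, f (N ω) ω ≤ f k ω + η := by
  classical
  have hex : ∀ ω, ∃ n, ∀ k, f n ω ≤ f k ω + η := fun ω => by
    obtain ⟨n, hn⟩ := exists_lt_of_ciInf_lt (lt_add_of_pos_right (⨅ k, f k ω) hη)
    exact ⟨n, fun k => hn.le.trans
      (add_le_add_left (ciInf_le ⟨0, by rintro _ ⟨k, rfl⟩; exact h0 k ω⟩ k) η)⟩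
  refine ⟨fun ω => Nat.find (hex ω), measurable_find hex fun n => ?_,
    fun ω => Nat.find_spec (hex ω)⟩
  have : {ω | ∀ k, f n ω ≤ f k ω + η} = ⋂ k, {ω | f n ω ≤ f k ω + η} := by
    ext ω
    simp
  rw [this]
  exact MeasurableSet.iInter fun k => measurableSet_le (hf n) ((hf k).add_const η)

/-! ### The score function and its expected Jacobian -/

section Score

variable {dX d : ℕ} {𝒳 : Set (Vec dX)} {ν : Measure (𝒳 × ℝ)} {g : 𝒳 → ℝ → Vec d → Vec d}
  {θstar : Vec d} {R : ℝ}

lemma measurable_fderiv_score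
    (hg : ∀ θ, Measurable (fun z : 𝒳 × ℝ => g z.1 z.2 θ))
    (hd : ∀ x y, Differentiable ℝ (g x y)) (θ v : Vec d) :
    Measurable (fun z : 𝒳 × ℝ => fderiv ℝ (g z.1 z.2) θ v) := by
  -- the directional derivative is a limit of difference quotients
  refine measurable_of_tendsto_metrizable (f := fun (n : ℕ) (z : 𝒳 × ℝ) =>
    (n : ℝ) • (g z.1 z.2 (θ + (n : ℝ)⁻¹ • v) - g z.1 z.2 θ))
    (fun n => ((hg (θ + (n : ℝ)⁻¹ • v)).sub (hg θ)).const_smul (n : ℝ)) ?_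
  rw [tendsto_pi_nhds]
  intro z
  refine (hd z.1 z.2 θ).hasFDerivAt.lim v ?_
  simp only [Real.norm_natCast]
  exact tendsto_natCast_atTop_atTop

lemma BoundedMoments.memLp_two (h : BoundedMoments ν g θstar R)
    (hg : ∀ θ, Measurable (fun z : 𝒳 × ℝ => g z.1 z.2 θ)) {θ : Vec d} (hθ : ‖θ‖ ≤ R) :
    MemLp (fun z : 𝒳 × ℝ => g z.1 z.2 θ) 2 ν := by
  refine ⟨(hg θ).aestronglyMeasurable, ?_⟩
  rw [eLpNorm_lt_top_iff_lintegral_rpow_enorm_lt_top (by norm_num) (by norm_num)]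
  refine lt_of_le_of_lt ?_ h.second
  refine le_trans (le_of_eq ?_) (le_iSup₂ (f := fun (θ : Vec d) (_ : ‖θ‖ ≤ R) =>
    ∫⁻ z, ‖g z.1 z.2 θ‖ₑ ^ 2 ∂ν) θ hθ)
  simp

lemma BoundedMoments.memLp_four (h : BoundedMoments ν g θstar R)
    (hg : ∀ θ, Measurable (fun z : 𝒳 × ℝ => g z.1 z.2 θ)) :
    MemLp (fun z : 𝒳 × ℝ => g z.1 z.2 θstar) 4 ν := by
  refine ⟨(hg θstar).aestronglyMeasurable, ?_⟩
  rw [eLpNorm_lt_top_iff_lintegral_rpow_enorm_lt_top (by norm_num) (by norm_num)]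
  refine lt_of_le_of_lt (le_of_eq ?_) h.fourth
  congr 1
  ext z
  exact ENNReal.rpow_natCast _ 4

/-- The expected Jacobian as a linear map. -/
noncomputable def meanDeriv (ν : Measure (𝒳 × ℝ))
    (g : 𝒳 → ℝ → Vec d → Vec d) (θstar : Vec d) : Vec d →L[ℝ] Vec d :=
  Matrix.toEuclideanCLM (𝕜 := ℝ) (meanJacobian ν g θstar)

/-- The inverse of the expected Jacobian as a linear map. -/
noncomputable def meanDerivInv (ν : Measure (𝒳 × ℝ))
    (g : 𝒳 → ℝ → Vec d → Vec d) (θstar : Vec d) : Vec d →L[ℝ] Vec d :=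
  Matrix.toEuclideanCLM (𝕜 := ℝ) (meanJacobian ν g θstar)⁻¹

lemma SmoothScore.exists_hessian_bound (h : SmoothScore ν g θstar R) :
    ∃ ε₀ : ℝ, 0 < ε₀ ∧ ∃ Φ : 𝒳 → ℝ → ℝ,
      (∀ x y θ, ‖θ - θstar‖ ≤ ε₀ → ∀ i : Fin d,
        ‖fderiv ℝ (fderiv ℝ (fun η : Vec d => g x y η i)) θ‖ ≤ Φ x y) ∧
      Integrable (fun z => d * Φ z.1 z.2) ν ∧ ∀ z : 𝒳 × ℝ, 0 ≤ d * Φ z.1 z.2 := by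
  obtain ⟨ε₀, hε₀, Φ, hΦ, hΦ1⟩ := h.second_deriv
  refine ⟨ε₀, hε₀, Φ, hΦ, hΦ1.const_mul _, fun z => ?_⟩
  rcases Nat.eq_zero_or_pos d with rfl | hd
  · simp
  · exact mul_nonneg (Nat.cast_nonneg _)
      (le_trans (norm_nonneg (fderiv ℝ (fderiv ℝ (fun η : Vec d => g z.1 z.2 η ⟨0, hd⟩)) θstar))
        (hΦ z.1 z.2 θstar (by simpa using hε₀.le) _))

lemma SmoothScore.meanDerivInv_meanDeriv (h : SmoothScore ν g θstar R)
    (v : Vec d) : meanDerivInv ν g θstar (meanDeriv ν g θstar v) = v := by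
  have hdet := (Matrix.isUnit_iff_isUnit_det _).1 h.nonsingular
  change (meanDerivInv ν g θstar * meanDeriv ν g θstar) v = v
  rw [meanDerivInv, meanDeriv, ← map_mul, Matrix.nonsing_inv_mul _ hdet, map_one]
  rfl

lemma SmoothScore.meanDeriv_meanDerivInv (h : SmoothScore ν g θstar R)
    (v : Vec d) : meanDeriv ν g θstar (meanDerivInv ν g θstar v) = v := by
  have hdet := (Matrix.isUnit_iff_isUnit_det _).1 h.nonsingular
  change (meanDeriv ν g θstar * meanDerivInv ν g θstar) v = v
  rw [meanDerivInv, meanDeriv, ← map_mul, Matrix.mul_nonsing_inv _ hdet, map_one]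
  rfl

lemma meanDeriv_single_apply (j i : Fin d) :
    meanDeriv ν g θstar (EuclideanSpace.single j 1) i =
      ∫ z, (fderiv ℝ (g z.1 z.2) θstar (EuclideanSpace.single j 1)) i ∂ν := by
  rw [meanDeriv, Matrix.ofLp_toEuclideanCLM, PiLp.ofLp_single, Matrix.mulVec_single_one]
  rfl

end Score

/-! ### The weighted estimating function -/

namespace Experiment

variable {dX K d : ℕ} {𝒳 : Set (Vec dX)} {Ω : Type*}

variable {D : Experiment 𝒳 K Ω} {g : 𝒳 → ℝ → Vec d → Vec d} {θstar : Vec d} {R : ℝ}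

lemma ipwScore_eq_ipwMean (a : Fin K) (T : ℕ) (θ : Vec d) (ω : Ω) :
    D.ipwScore g a T θ ω = D.ipwMean a (fun z => g z.1 z.2 θ) T ω := rfl

/-- The estimating function is a function of the data. -/
lemma measurable_ipwScore (hg : ∀ θ, Measurable (fun z : 𝒳 × ℝ => g z.1 z.2 θ)) (a : Fin K)
    (T : ℕ) (θ : Vec d) : Measurable[D.histSigma T] (D.ipwScore g a T θ) := by
  have h := D.measurable_ipwMean a (hg θ) T
  exact h

/-- A parameter in the ball that nearly minimizes the norm of the estimating function over the ball
can be selected as a measurable function of the data: by continuity it suffices to search through a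
dense sequence. -/
lemma exists_near_minimizer (D : Experiment 𝒳 K Ω) (a : Fin K)
    (hg : ∀ θ, Measurable (fun z : 𝒳 × ℝ => g z.1 z.2 θ)) (hcg : ∀ x y, Continuous (g x y))
    (hR : 0 ≤ R) (T : ℕ) {η : ℝ} (hη : 0 < η) :
    ∃ θhat : Ω → Vec d, Measurable[D.histSigma T] θhat ∧ (∀ ω, ‖θhat ω‖ ≤ R) ∧
      ∀ ω (θ : Vec d), ‖θ‖ ≤ R →
        ‖D.ipwScore g a T (θhat ω) ω‖ ≤ ‖D.ipwScore g a T θ ω‖ + η := by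
  have hne : Nonempty (Metric.closedBall (0 : Vec d) R) :=
    ⟨⟨0, mem_closedBall_zero_iff.2 (by simpa using hR)⟩⟩
  obtain ⟨q, hq⟩ := TopologicalSpace.exists_dense_seq (Metric.closedBall (0 : Vec d) R)
  obtain ⟨N, hNm, hNmin⟩ := @exists_measurable_near_min Ω (D.histSigma T)
    (fun n ω => ‖D.ipwScore g a T (q n) ω‖)
    (fun n => measurable_norm.comp (measurable_ipwScore hg a T (q n)))
    (fun _ _ => norm_nonneg _) η hη
  have hmeas : Measurable[D.histSigma T] (fun ω => (q (N ω) : Vec d)) :=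
    (measurable_from_nat (f := fun n => (q n : Vec d))).comp hNm
  have hball : ∀ ω, ‖(q (N ω) : Vec d)‖ ≤ R := fun ω => mem_closedBall_zero_iff.1 (q _).2
  refine ⟨fun ω => q (N ω), hmeas, hball, fun ω θ hθ => ?_⟩
  specialize hNmin ω
  beta_reduce
  have hcont : Continuous (fun θ => D.ipwScore g a T θ ω) := by
    unfold ipwScore
    fun_prop
  generalize (q (N ω) : Vec d) = θ₀ at hNmin ⊢
  have hclosed : IsClosed {x : Metric.closedBall (0 : Vec d) R |
      ‖D.ipwScore g a T θ₀ ω‖ ≤ ‖D.ipwScore g a T x ω‖ + η} :=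
    isClosed_le continuous_const
      (((hcont.comp continuous_subtype_val).norm).add continuous_const)
  exact isClosed_property hq hclosed hNmin ⟨θ, mem_closedBall_zero_iff.2 hθ⟩

variable [mΩ : MeasurableSpace Ω] {P : Measure Ω} {Q : Measure (𝒳 × (Fin K → ℝ))} {π : Policy 𝒳 K}

namespace IsGenerated

/-- Lipschitz bound for the estimating function on the parameter ball. -/
lemma norm_ipwScore_sub_le (hD : D.IsGenerated P Q π) (a : Fin K)
    (hd : ∀ x y, Differentiable ℝ (g x y)) {φ : 𝒳 → ℝ → ℝ}
    (hφ : ∀ x y θ, ‖θ‖ ≤ R → ‖fderiv ℝ (g x y) θ‖ ≤ φ x y) {θ θ' : Vec d} (hθ : ‖θ‖ ≤ R)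
    (hθ' : ‖θ'‖ ≤ R) (T : ℕ) (ω : Ω) :
    ‖D.ipwScore g a T θ ω - D.ipwScore g a T θ' ω‖ ≤
      D.ipwMean a (fun z => φ z.1 z.2) T ω * ‖θ - θ'‖ := by
  change ‖D.ipwMean a (fun z => g z.1 z.2 θ) T ω - D.ipwMean a (fun z => g z.1 z.2 θ') T ω‖ ≤ _
  rw [← ipwMean_sub, ← ipwMean_mul_const]
  exact hD.norm_ipwMean_le a
    (fun z => norm_sub_le_of_norm_fderiv_le (hd z.1 z.2) (hφ z.1 z.2) hθ hθ') T ω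

/-- Second-order Taylor bound for the estimating function. -/
lemma norm_ipwScore_taylor_le (hD : D.IsGenerated P Q π) (a : Fin K)
    (hd : ∀ x y, Differentiable ℝ (g x y) ∧ Differentiable ℝ (fderiv ℝ (g x y)))
    {Φ : 𝒳 → ℝ → ℝ} {ε₀ : ℝ} (hΦ : ∀ x y θ, ‖θ - θstar‖ ≤ ε₀ → ∀ i : Fin d,
      ‖fderiv ℝ (fderiv ℝ (fun η : Vec d => g x y η i)) θ‖ ≤ Φ x y) {θ : Vec d}
    (hθ : ‖θ - θstar‖ ≤ ε₀) (T : ℕ) (ω : Ω) :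
    ‖D.ipwScore g a T θ ω - D.ipwScore g a T θstar ω -
      D.ipwMean a (fun z => fderiv ℝ (g z.1 z.2) θstar) T ω (θ - θstar)‖ ≤
      D.ipwMean a (fun z => d * Φ z.1 z.2) T ω * ‖θ - θstar‖ ^ 2 := by
  have h1 : D.ipwMean a (fun z => fderiv ℝ (g z.1 z.2) θstar) T ω (θ - θstar) =
      D.ipwMean a (fun z => fderiv ℝ (g z.1 z.2) θstar (θ - θstar)) T ω :=
    ipwMean_clm_apply a _ T ω _
  change ‖D.ipwMean a (fun z => g z.1 z.2 θ) T ω - D.ipwMean a (fun z => g z.1 z.2 θstar) T ω -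
    _‖ ≤ _
  rw [h1, ← ipwMean_sub, ← ipwMean_sub, ← ipwMean_mul_const]
  exact hD.norm_ipwMean_le a (fun z => norm_sub_sub_fderiv_le (hd z.1 z.2).1 (hd z.1 z.2).2
    (hΦ z.1 z.2) hθ) T ω

variable [∀ t, IsMarkovKernel (π t)] [IsProbabilityMeasure P]

/-- Law of large numbers for vector-valued functions. -/
lemma tendstoInMeasure_ipwMean_sub_vec (hD : D.IsGenerated P Q π) (hU : D.Unconfounded P)
    {a : Fin K} {c : ℝ} (hc : 0 < c) (hpos : ∀ t, ∀ᵐ ω ∂P, c ≤ D.prob π t a ω)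
    {F : 𝒳 × ℝ → Vec d} (hF : Measurable F) (hF2 : MemLp F 2 (armLaw Q a)) {m : Vec d}
    (hm : ∀ i, m i = ∫ z, F z i ∂armLaw Q a) :
    TendstoInMeasure P (fun T ω => D.ipwMean a F T ω - m) atTop (fun _ => (0 : Vec d)) := by
  refine tendstoInMeasure_zero_of_coord fun i => ?_
  have hFi : Measurable (fun z => F z i) := by fun_prop
  have hFi2 : MemLp (fun z => F z i) 2 (armLaw Q a) :=
    hF2.mono hFi.aestronglyMeasurable (ae_of_all _ fun z => PiLp.norm_apply_le (F z) i)
  refine (hD.tendstoInMeasure_ipwMean_sub hU hc hpos hFi hFi2).congr_left fun T =>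
    ae_of_all _ fun ω => ?_
  simp only [PiLp.sub_apply, ipwMean_apply, hm]

lemma stochBounded_sqrt_smul_ipwMean (hD : D.IsGenerated P Q π) (hU : D.Unconfounded P)
    {a : Fin K} {c : ℝ} (hc : 0 < c) (hpos : ∀ t, ∀ᵐ ω ∂P, c ≤ D.prob π t a ω)
    {F : 𝒳 × ℝ → Vec d} (hF : Measurable F) (hF2 : MemLp F 2 (armLaw Q a))
    (h0 : ∀ i, ∫ z, F z i ∂armLaw Q a = 0) :
    StochBounded P (fun (T : ℕ) ω => ‖√(T : ℝ) • D.ipwMean a F T ω‖) := by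
  have hb : StochBounded P (fun (T : ℕ) ω => ∑ i, |√(T : ℝ) * D.ipwMean a (fun z => F z i) T ω|) :=
    StochBounded.sum _ fun i _ => by
      have hFi : Measurable (fun z => F z i) := by fun_prop
      exact (hD.stochBounded_sqrt_mul_ipwMean hU hc hpos hFi
        (hF2.mono hFi.aestronglyMeasurable (ae_of_all _ fun z => PiLp.norm_apply_le (F z) i))
        (h0 i)).of_le fun n ω => by simp
  refine hb.of_le fun T ω => ?_
  rw [norm_norm, Real.norm_of_nonneg (Finset.sum_nonneg fun _ _ => abs_nonneg _)]
  refine (norm_le_sum_abs _).trans (le_of_eq ?_)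
  simp [ipwMean_apply]

/-- The empirical Jacobian at the true parameter is consistent. -/
lemma tendstoInMeasure_ipwMean_fderiv (hD : D.IsGenerated P Q π) (hU : D.Unconfounded P)
    {a : Fin K} {c : ℝ} (hc : 0 < c) (hpos : ∀ t, ∀ᵐ ω ∂P, c ≤ D.prob π t a ω)
    (hg : ∀ θ, Measurable (fun z : 𝒳 × ℝ => g z.1 z.2 θ))
    (hmom : BoundedMoments (armLaw Q a) g θstar R) (hsm : SmoothScore (armLaw Q a) g θstar R) :
    TendstoInMeasure P (fun T ω => ‖D.ipwMean a (fun z => fderiv ℝ (g z.1 z.2) θstar) T ω -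
      meanDeriv (armLaw Q a) g θstar‖) atTop (fun _ => (0 : ℝ)) := by
  obtain ⟨φ, hφ, hφ2⟩ := hsm.first_deriv
  have hcol : ∀ j : Fin d, TendstoInMeasure P (fun T ω =>
      D.ipwMean a (fun z => fderiv ℝ (g z.1 z.2) θstar (EuclideanSpace.single j 1)) T ω -
        meanDeriv (armLaw Q a) g θstar (EuclideanSpace.single j 1)) atTop
        (fun _ => (0 : Vec d)) := fun j => by
    have hm := measurable_fderiv_score hg (fun x y => (hsm.differentiable x y).1) θstar
      (EuclideanSpace.single j 1)
    refine hD.tendstoInMeasure_ipwMean_sub_vec hU hc hpos hm ?_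
      fun i => meanDeriv_single_apply j i
    refine hφ2.mono hm.aestronglyMeasurable (ae_of_all _ fun z => ?_)
    refine (ContinuousLinearMap.le_opNorm _ _).trans ?_
    rw [PiLp.norm_single, norm_one, mul_one]
    exact (hφ z.1 z.2 θstar hmom.norm_lt.le).trans (Real.le_norm_self _)
  refine tendstoInMeasure_zero_of_le (tendstoInMeasure_zero_sum Finset.univ fun j _ =>
    tendstoInMeasure_zero_norm (hcol j)) (Eventually.of_forall fun T => ae_of_all _ fun ω => ?_)
  rw [norm_norm]
  refine (opNorm_le_sum_single _).trans (le_of_eq (Finset.sum_congr rfl fun j _ => ?_))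
  rw [_root_.sub_apply]
  congr 2
  exact ipwMean_clm_apply a _ T ω _

end IsGenerated

end Experiment

/-! ### Consistency and asymptotic linearity -/

namespace Experiment.IsGenerated

variable {dX K d : ℕ} {𝒳 : Set (Vec dX)} {Ω : Type*} [mΩ : MeasurableSpace Ω] {P : Measure Ω}
  {Q : Measure (𝒳 × (Fin K → ℝ))} {π : Policy 𝒳 K} {D : Experiment 𝒳 K Ω}
  {g : 𝒳 → ℝ → Vec d → Vec d} {θstar : Vec d} {R : ℝ}
  [∀ t, IsMarkovKernel (π t)] [IsProbabilityMeasure P]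

/-- Pointwise law of large numbers for the estimating function. -/
lemma tendstoInMeasure_ipwScore_sub (hD : D.IsGenerated P Q π) (hU : D.Unconfounded P)
    {a : Fin K} {c : ℝ} (hc : 0 < c) (hpos : ∀ t, ∀ᵐ ω ∂P, c ≤ D.prob π t a ω)
    (hg : ∀ θ, Measurable (fun z : 𝒳 × ℝ => g z.1 z.2 θ))
    (hmom : BoundedMoments (armLaw Q a) g θstar R) {θ : Vec d} (hθ : ‖θ‖ ≤ R) :
    TendstoInMeasure P (fun T ω => D.ipwScore g a T θ ω - ∫ z, g z.1 z.2 θ ∂armLaw Q a) atTop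
      (fun _ => (0 : Vec d)) := by
  have := hD.isProbabilityMeasure_armLaw a
  have h2 := hmom.memLp_two hg hθ
  refine hD.tendstoInMeasure_ipwMean_sub_vec hU hc hpos (hg θ) h2 fun i => ?_
  exact integral_coord (h2.integrable (by norm_num)) i

/-- **Consistency.** Approximate roots in the parameter ball converge to the well-separated root,
by a uniform law of large numbers over the ball. -/
lemma tendstoInMeasure_sub_of_solves (hD : D.IsGenerated P Q π) (hU : D.Unconfounded P)
    {a : Fin K} {c : ℝ} (hc : 0 < c) (hpos : ∀ t, ∀ᵐ ω ∂P, c ≤ D.prob π t a ω)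
    (hg : ∀ θ, Measurable (fun z : 𝒳 × ℝ => g z.1 z.2 θ))
    (hsep : WellSeparated (armLaw Q a) g θstar) (hmom : BoundedMoments (armLaw Q a) g θstar R)
    (hsm : SmoothScore (armLaw Q a) g θstar R) {θhat : ℕ → Ω → Vec d}
    (hR : ∀ T, ∀ᵐ ω ∂P, ‖θhat T ω‖ ≤ R) (hsol : D.SolvesIPW P g a θhat) :
    TendstoInMeasure P (fun T ω => θhat T ω - θstar) atTop (fun _ => (0 : Vec d)) := by
  have := hD.isProbabilityMeasure_armLaw a
  obtain ⟨φ, hφ, hφ2⟩ := hsm.first_deriv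
  have hφ1 : Integrable (fun z : 𝒳 × ℝ => φ z.1 z.2) (armLaw Q a) :=
    hφ2.integrable (by norm_num)
  set m : Vec d → Vec d := fun θ => ∫ z, g z.1 z.2 θ ∂armLaw Q a
  set L := ∫ z, φ z.1 z.2 ∂armLaw Q a
  have hd : ∀ x y, Differentiable ℝ (g x y) := fun x y => (hsm.differentiable x y).1
  have hmLip : ∀ {θ θ' : Vec d}, ‖θ‖ ≤ R → ‖θ'‖ ≤ R → ‖m θ - m θ'‖ ≤ L * ‖θ - θ'‖ := by
    intro θ θ' hθ hθ'
    simp only [m]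
    rw [← integral_sub ((hmom.memLp_two hg hθ).integrable (by norm_num))
      ((hmom.memLp_two hg hθ').integrable (by norm_num)), ← integral_mul_const]
    exact norm_integral_le_of_norm_le (hφ1.mul_const _) (ae_of_all _ fun z =>
      norm_sub_le_of_norm_fderiv_le (hd z.1 z.2) (hφ z.1 z.2) hθ hθ')
  have hG : TendstoInMeasure P (fun T ω => D.ipwScore g a T (θhat T ω) ω) atTop
      (fun _ => (0 : Vec d)) := by
    refine tendstoInMeasure_zero_of_le (tendstoInMeasure_zero_norm hsol) ?_
    filter_upwards [eventually_ge_atTop 1] with T hT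
    refine ae_of_all _ fun ω => ?_
    rw [norm_smul, Real.norm_of_nonneg (Real.sqrt_nonneg _)]
    exact le_mul_of_one_le_left (norm_nonneg _) (Real.one_le_sqrt.2 (by exact_mod_cast hT))
  -- the population estimating function vanishes asymptotically along the estimators
  have hm : TendstoInMeasure P (fun T ω => m (θhat T ω)) atTop (fun _ => (0 : Vec d)) := by
    refine ((hD.stochBounded_ipwMean hc hpos hφ1).add
      (stochBounded_const P L)).tendstoInMeasure_of_le fun η hη => ?_
    obtain ⟨F, hFs, hFfin, hcov⟩ := (isCompact_closedBall (0 : Vec d) R).finite_cover_balls hη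
    refine ⟨fun T ω => (∑ q ∈ hFfin.toFinset, ‖D.ipwScore g a T q ω - m q‖) +
      ‖D.ipwScore g a T (θhat T ω) ω‖, ?_, fun T => ?_⟩
    · refine tendstoInMeasure_zero_add (tendstoInMeasure_zero_sum _ fun q hq => ?_)
        (tendstoInMeasure_zero_norm hG)
      refine tendstoInMeasure_zero_norm (hD.tendstoInMeasure_ipwScore_sub hU hc hpos hg hmom ?_)
      exact mem_closedBall_zero_iff.1 (hFs (hFfin.mem_toFinset.1 hq))
    · filter_upwards [hR T] with ω hω
      obtain ⟨q, hq, hqb⟩ := Set.mem_iUnion₂.1 (hcov (mem_closedBall_zero_iff.2 hω))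
      have hqR : ‖q‖ ≤ R := mem_closedBall_zero_iff.1 (hFs hq)
      rw [Metric.mem_ball, dist_eq_norm] at hqb
      have hL : 0 ≤ L := integral_nonneg fun z => (norm_nonneg _).trans (hφ z.1 z.2 q hqR)
      have hB : 0 ≤ D.ipwMean a (fun z => φ z.1 z.2) T ω :=
        (norm_nonneg _).trans (hD.norm_ipwMean_le a (F := fun z => φ z.1 z.2)
          (fun z => (Real.norm_of_nonneg ((norm_nonneg _).trans (hφ z.1 z.2 q hqR))).le) T ω)
      have h1 := (hmLip hω hqR).trans (mul_le_mul_of_nonneg_left hqb.le hL)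
      have h2 := (hD.norm_ipwScore_sub_le a hd hφ hω hqR T ω).trans
        (mul_le_mul_of_nonneg_left hqb.le hB)
      have h3 : ‖D.ipwScore g a T q ω - m q‖ ≤
          ∑ q ∈ hFfin.toFinset, ‖D.ipwScore g a T q ω - m q‖ :=
        Finset.single_le_sum (f := fun q => ‖D.ipwScore g a T q ω - m q‖)
          (fun _ _ => norm_nonneg _) (hFfin.mem_toFinset.2 hq)
      have h4 : m (θhat T ω) = (m (θhat T ω) - m q) - (D.ipwScore g a T q ω - m q) -
          (D.ipwScore g a T (θhat T ω) ω - D.ipwScore g a T q ω) +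
          D.ipwScore g a T (θhat T ω) ω := by abel
      have h5 := norm_add_le ((m (θhat T ω) - m q) - (D.ipwScore g a T q ω - m q) -
          (D.ipwScore g a T (θhat T ω) ω - D.ipwScore g a T q ω))
          (D.ipwScore g a T (θhat T ω) ω)
      have h6 := norm_sub_le ((m (θhat T ω) - m q) - (D.ipwScore g a T q ω - m q))
          (D.ipwScore g a T (θhat T ω) ω - D.ipwScore g a T q ω)
      have h7 := norm_sub_le (m (θhat T ω) - m q) (D.ipwScore g a T q ω - m q)
      rw [← h4] at h5
      linarith
  rw [tendstoInMeasure_zero_iff] at hm ⊢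
  intro ε hε
  -- away from `θstar`, the population estimating function is bounded below by some `δ > 0`
  obtain ⟨δ, -, hδ0, hδ⟩ := ENNReal.lt_iff_exists_real_btwn.1 (hsep (ε / 2) (half_pos hε))
  rw [ENNReal.ofReal_pos] at hδ0
  refine tendsto_of_tendsto_of_tendsto_of_le_of_le tendsto_const_nhds (hm δ hδ0)
    (fun _ => zero_le) fun T => measure_mono fun ω (hω : ε ≤ ‖θhat T ω - θstar‖) => ?_
  have h1 : ENNReal.ofReal δ ≤ ‖m (θhat T ω)‖ₑ :=
    hδ.le.trans (iInf₂_le (θhat T ω) ((half_lt_self hε).trans_le hω))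
  rw [← ofReal_norm] at h1
  exact (ENNReal.ofReal_le_ofReal_iff (norm_nonneg _)).1 h1

/-- The control on the slope in `norm_linearization_le` tends to zero in probability at a
consistent sequence. -/
lemma tendstoInMeasure_slope_error (hD : D.IsGenerated P Q π) (hU : D.Unconfounded P)
    {a : Fin K} {c : ℝ} (hc : 0 < c) (hpos : ∀ t, ∀ᵐ ω ∂P, c ≤ D.prob π t a ω)
    (hg : ∀ θ, Measurable (fun z : 𝒳 × ℝ => g z.1 z.2 θ))
    (hmom : BoundedMoments (armLaw Q a) g θstar R) (hsm : SmoothScore (armLaw Q a) g θstar R)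
    {Φ : 𝒳 × ℝ → ℝ} (hΦ : Integrable Φ (armLaw Q a)) {Δ : ℕ → Ω → Vec d}
    (hΔ : TendstoInMeasure P Δ atTop (fun _ => (0 : Vec d))) :
    TendstoInMeasure P (fun T ω => D.ipwMean a Φ T ω * ‖Δ T ω‖ +
      ‖D.ipwMean a (fun z => fderiv ℝ (g z.1 z.2) θstar) T ω - meanDeriv (armLaw Q a) g θstar‖)
      atTop (fun _ => (0 : ℝ)) := by
  refine tendstoInMeasure_zero_add ?_ (hD.tendstoInMeasure_ipwMean_fderiv hU hc hpos hg hmom hsm)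
  simpa only [mul_comm] using (hD.stochBounded_ipwMean hc hpos hΦ).tendstoInMeasure_mul
    (tendstoInMeasure_zero_norm hΔ)

/-- The normalized estimating function at the true parameter is bounded in probability. -/
lemma stochBounded_ipwScore (hD : D.IsGenerated P Q π) (hU : D.Unconfounded P)
    {a : Fin K} {c : ℝ} (hc : 0 < c) (hpos : ∀ t, ∀ᵐ ω ∂P, c ≤ D.prob π t a ω)
    (hg : ∀ θ, Measurable (fun z : 𝒳 × ℝ => g z.1 z.2 θ))
    (hroot : ∫ z, g z.1 z.2 θstar ∂armLaw Q a = 0)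
    (hmom : BoundedMoments (armLaw Q a) g θstar R) :
    StochBounded P (fun (T : ℕ) ω => ‖√(T : ℝ) • D.ipwScore g a T θstar ω‖) := by
  have := hD.isProbabilityMeasure_armLaw a
  have hθ : ‖θstar‖ ≤ R := hmom.norm_lt.le
  have h2 := hmom.memLp_two hg hθ
  simp only [ipwScore_eq_ipwMean]
  refine hD.stochBounded_sqrt_smul_ipwMean hU hc hpos (hg θstar) h2 fun i => ?_
  rw [← integral_coord (h2.integrable (by norm_num)) i, hroot]
  rfl

/-- **Asymptotic linearity** of approximate roots of the estimating equation. -/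
lemma tendstoInMeasure_linearization (hD : D.IsGenerated P Q π) (hU : D.Unconfounded P)
    {a : Fin K} {c : ℝ} (hc : 0 < c) (hpos : ∀ t, ∀ᵐ ω ∂P, c ≤ D.prob π t a ω)
    (hg : ∀ θ, Measurable (fun z : 𝒳 × ℝ => g z.1 z.2 θ))
    (hroot : ∫ z, g z.1 z.2 θstar ∂armLaw Q a = 0)
    (hsep : WellSeparated (armLaw Q a) g θstar) (hmom : BoundedMoments (armLaw Q a) g θstar R)
    (hsm : SmoothScore (armLaw Q a) g θstar R) {θhat : ℕ → Ω → Vec d}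
    (hR : ∀ T, ∀ᵐ ω ∂P, ‖θhat T ω‖ ≤ R) (hsol : D.SolvesIPW P g a θhat) :
    TendstoInMeasure P (fun (T : ℕ) ω => √(T : ℝ) • (θhat T ω - θstar) +
      meanDerivInv (armLaw Q a) g θstar (√(T : ℝ) • D.ipwScore g a T θstar ω)) atTop
      (fun _ => (0 : Vec d)) := by
  obtain ⟨ε₀, hε₀, Φ, hΦ, hΦ1, hΦ0⟩ := hsm.exists_hessian_bound
  have hcons := hD.tendstoInMeasure_sub_of_solves hU hc hpos hg hsep hmom hsm hR hsol
  set Jinv := meanDerivInv (armLaw Q a) g θstar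
  set B : ℕ → Ω → ℝ := D.ipwMean a (fun z => d * Φ z.1 z.2)
  set κ : ℕ → Ω → ℝ := fun T ω => B T ω * ‖θhat T ω - θstar‖ +
    ‖D.ipwMean a (fun z => fderiv ℝ (g z.1 z.2) θstar) T ω - meanDeriv (armLaw Q a) g θstar‖
  have hκ : TendstoInMeasure P κ atTop (fun _ => (0 : ℝ)) :=
    hD.tendstoInMeasure_slope_error hU hc hpos hg hmom hsm hΦ1 hcons
  have hctl := tendstoInMeasure_zero_add (tendstoInMeasure_zero_norm hcons)
    (tendstoInMeasure_zero_const_mul ‖Jinv‖ hκ)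
  have hX := tendstoInMeasure_zero_add
    (tendstoInMeasure_zero_const_mul (2 * ‖Jinv‖) (tendstoInMeasure_zero_norm hsol))
    (tendstoInMeasure_zero_const_mul (2 * ‖Jinv‖ ^ 2)
      ((hD.stochBounded_ipwScore hU hc hpos hg hroot hmom).tendstoInMeasure_mul hκ))
  refine tendstoInMeasure_zero_of_le_on (δ := min ε₀ (1 / 2)) (by positivity) hctl hX
    (Eventually.of_forall fun T => ae_of_all _ fun ω hω => ?_)
  have hB0 : 0 ≤ B T ω := hD.ipwMean_nonneg a hΦ0 T ω
  have hκ0 : 0 ≤ κ T ω := by positivity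
  have h1 : ‖θhat T ω - θstar‖ ≤ ε₀ := by
    have := hω.le.trans (min_le_left _ _)
    have h : 0 ≤ ‖Jinv‖ * κ T ω := by positivity
    linarith
  have h2 : ‖Jinv‖ * κ T ω ≤ 1 / 2 := by
    have := hω.le.trans (min_le_right _ _)
    linarith [norm_nonneg (θhat T ω - θstar)]
  exact norm_linearization_le hsm.meanDerivInv_meanDeriv hB0 (Real.sqrt_nonneg _)
    (hD.norm_ipwScore_taylor_le a hsm.differentiable hΦ h1 T ω) h2

/-- **Existence of estimators.** Nearly minimizing the norm of the estimating function over the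
parameter ball yields approximate roots: the one-step Newton iterate from the true parameter lies
in the ball with probability tending to one, and solves the equation up to `o_p(1/√T)`. -/
lemma exists_estimator (hD : D.IsGenerated P Q π) (hU : D.Unconfounded P)
    {a : Fin K} {c : ℝ} (hc : 0 < c) (hpos : ∀ t, ∀ᵐ ω ∂P, c ≤ D.prob π t a ω)
    (hg : ∀ θ, Measurable (fun z : 𝒳 × ℝ => g z.1 z.2 θ))
    (hroot : ∫ z, g z.1 z.2 θstar ∂armLaw Q a = 0)
    (hmom : BoundedMoments (armLaw Q a) g θstar R) (hsm : SmoothScore (armLaw Q a) g θstar R) :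
    ∃ θhat : ℕ → Ω → Vec d, (∀ T, Measurable[D.histSigma T] (θhat T)) ∧
      (∀ T ω, ‖θhat T ω‖ ≤ R) ∧ D.SolvesIPW P g a θhat := by
  choose θhat hmeas hball hmin using fun T : ℕ => exists_near_minimizer D a hg
    (fun x y => (hsm.differentiable x y).1.continuous) ((norm_nonneg _).trans hmom.norm_lt.le) T
    (η := 1 / (T + 1 : ℝ)) (by positivity)
  refine ⟨θhat, hmeas, hball, ?_⟩
  obtain ⟨ε₀, hε₀, Φ, hΦ, hΦ1, hΦ0⟩ := hsm.exists_hessian_bound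
  set J := meanDeriv (armLaw Q a) g θstar
  set Jinv := meanDerivInv (armLaw Q a) g θstar
  set B : ℕ → Ω → ℝ := D.ipwMean a (fun z => d * Φ z.1 z.2)
  -- `Δ` is the Newton step from the true parameter
  set Δ : ℕ → Ω → Vec d := fun T ω => -Jinv (D.ipwScore g a T θstar ω)
  have hG0 : TendstoInMeasure P (fun T ω => D.ipwScore g a T θstar ω) atTop
      (fun _ => (0 : Vec d)) := by
    have hθ : ‖θstar‖ ≤ R := hmom.norm_lt.le
    have h := hD.tendstoInMeasure_ipwScore_sub hU hc hpos hg hmom hθ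
    simpa only [hroot, sub_zero] using h
  have hΔ : TendstoInMeasure P Δ atTop (fun _ => (0 : Vec d)) :=
    tendstoInMeasure_zero_of_le
      (tendstoInMeasure_zero_const_mul ‖Jinv‖ (tendstoInMeasure_zero_norm hG0))
      (Eventually.of_forall fun T => ae_of_all _ fun ω => by
        simpa [Δ] using Jinv.le_opNorm (D.ipwScore g a T θstar ω))
  set κ : ℕ → Ω → ℝ := fun T ω => B T ω * ‖Δ T ω‖ +
    ‖D.ipwMean a (fun z => fderiv ℝ (g z.1 z.2) θstar) T ω - J‖
  have hκ : TendstoInMeasure P κ atTop (fun _ => (0 : ℝ)) :=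
    hD.tendstoInMeasure_slope_error hU hc hpos hg hmom hsm hΦ1 hΔ
  have hrate : Tendsto (fun T : ℕ => √(T : ℝ) * (1 / (T + 1 : ℝ))) atTop (nhds 0) := by
    have h1 : Tendsto (fun T : ℕ => (√(T : ℝ))⁻¹) atTop (nhds 0) :=
      tendsto_inv_atTop_zero.comp (Real.tendsto_sqrt_atTop.comp tendsto_natCast_atTop_atTop)
    refine squeeze_zero (fun T => by positivity) (fun T => ?_) h1
    rcases Nat.eq_zero_or_pos T with rfl | hT
    · simp
    · have hs : 0 < √(T : ℝ) := Real.sqrt_pos.2 (by exact_mod_cast hT)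
      rw [mul_one_div, ← one_div, div_le_div_iff₀ (by positivity) hs, one_mul,
        Real.mul_self_sqrt (Nat.cast_nonneg T)]
      linarith
  have hX := tendstoInMeasure_zero_add
    (tendstoInMeasure_zero_const_mul ‖Jinv‖
      ((hD.stochBounded_ipwScore hU hc hpos hg hroot hmom).tendstoInMeasure_mul hκ))
    (tendstoInMeasure_zero_const P hrate)
  have hr0 : 0 < R - ‖θstar‖ := sub_pos.2 hmom.norm_lt
  refine tendstoInMeasure_zero_of_le_on (δ := min ε₀ (R - ‖θstar‖)) (by positivity)
    (tendstoInMeasure_zero_norm hΔ) hX (Eventually.of_forall fun T => ae_of_all _ fun ω hω => ?_)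
  have h1 : ‖θstar + Δ T ω - θstar‖ ≤ ε₀ := by
    rw [add_sub_cancel_left]
    exact hω.le.trans (min_le_left _ _)
  have h2 : ‖θstar + Δ T ω‖ ≤ R := by
    have := hω.le.trans (min_le_right _ _)
    linarith [norm_add_le θstar (Δ T ω)]
  have htay := hD.norm_ipwScore_taylor_le a hsm.differentiable hΦ h1 T ω
  rw [add_sub_cancel_left] at htay
  set A := D.ipwMean a (fun z => fderiv ℝ (g z.1 z.2) θstar) T ω
  set Gs := D.ipwScore g a T θstar ω
  set Gh := D.ipwScore g a T (θstar + Δ T ω) ω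
  have hJΔ : J (Δ T ω) = -Gs := by
    simp only [Δ, map_neg]
    rw [hsm.meanDeriv_meanDerivInv]
  have hGh : Gh = (Gh - Gs - A (Δ T ω)) + (A - J) (Δ T ω) := by
    rw [_root_.sub_apply, hJΔ]
    abel
  have hΔle : ‖Δ T ω‖ ≤ ‖Jinv‖ * ‖Gs‖ := by
    simpa [Δ] using Jinv.le_opNorm Gs
  have hκ0 : ‖Gh‖ ≤ κ T ω * ‖Δ T ω‖ := by
    rw [hGh]
    refine (norm_add_le _ _).trans ((add_le_add htay ((A - J).le_opNorm _)).trans (le_of_eq ?_))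
    simp only [κ, A, B]
    ring
  have hκnn : 0 ≤ κ T ω := by
    have hB0 : 0 ≤ B T ω := hD.ipwMean_nonneg a hΦ0 T ω
    positivity
  have hs := Real.sqrt_nonneg (T : ℝ)
  rw [norm_smul, norm_smul, Real.norm_of_nonneg hs]
  calc √(T : ℝ) * ‖D.ipwScore g a T (θhat T ω) ω‖
      ≤ √(T : ℝ) * (‖Gh‖ + 1 / (T + 1 : ℝ)) := by gcongr; exact hmin T ω _ h2
    _ ≤ √(T : ℝ) * (κ T ω * (‖Jinv‖ * ‖Gs‖) + 1 / (T + 1 : ℝ)) := by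
        gcongr
        exact hκ0.trans (mul_le_mul_of_nonneg_left hΔle hκnn)
    _ = _ := by ring

end Experiment.IsGenerated

/-! ### The limiting covariance -/

section BlockDiagonal

variable {m o : Type*} [Fintype m] [Fintype o] [DecidableEq o]

lemma dotProduct_blockDiagonal_mulVec (M : o → Matrix m m ℝ) (v : m × o → ℝ) :
    v ⬝ᵥ Matrix.blockDiagonal M *ᵥ v =
      ∑ a, (fun i => v (i, a)) ⬝ᵥ M a *ᵥ (fun i => v (i, a)) := by
  simp only [dotProduct, mulVec, Fintype.sum_prod_type, Matrix.blockDiagonal_apply, ite_mul,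
    zero_mul, Finset.sum_ite_eq, Finset.mem_univ, if_true]
  exact Finset.sum_comm

lemma posSemidef_blockDiagonal {M : o → Matrix m m ℝ} (hM : ∀ a, (M a).PosSemidef) :
    (Matrix.blockDiagonal M).PosSemidef := by
  rw [Matrix.posSemidef_iff_dotProduct_mulVec]
  refine ⟨?_, fun v => ?_⟩
  · rw [Matrix.IsHermitian, Matrix.blockDiagonal_conjTranspose]
    exact congrArg _ (funext fun a => (hM a).isHermitian)
  · rw [star_trivial, dotProduct_blockDiagonal_mulVec]
    exact Finset.sum_nonneg fun a _ => by
      simpa using (hM a).dotProduct_mulVec_nonneg (fun i => v (i, a))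

end BlockDiagonal

section Covariance

variable {dX K d : ℕ} {𝒳 : Set (Vec dX)} {ν : Measure (𝒳 × ℝ)} {g : 𝒳 → ℝ → Vec d → Vec d}
  {θstar : Vec d} {πbar : Kernel 𝒳 (Fin K)} {a : Fin K}

lemma integrable_one_div_policy_mul {c : ℝ} (hc : 0 < c)
    (hbar : ∀ᵐ z ∂ν, c ≤ (πbar z.1).real {a}) {f h : 𝒳 × ℝ → ℝ} (hf : MemLp f 2 ν)
    (hh : MemLp h 2 ν) : Integrable (fun z => (1 / (πbar z.1).real {a}) * (f z * h z)) ν := by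
  have hm : Measurable (fun z : 𝒳 × ℝ => 1 / (πbar z.1).real {a}) :=
    ((Kernel.measurable_coe πbar (measurableSet_singleton a)).ennreal_toReal.comp
      measurable_fst).const_div 1
  refine (hf.integrable_mul hh).bdd_mul hm.aestronglyMeasurable (c := 1 / c) ?_
  filter_upwards [hbar] with z hz
  rw [Real.norm_of_nonneg (one_div_nonneg.2 measureReal_nonneg)]
  exact one_div_le_one_div_of_le hc hz

/-- The quadratic form of the asymptotic covariance is the weighted second moment of the
corresponding linear functional of the influence function `J⁻¹ g`. -/
lemma dotProduct_asympCov_mulVec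
    (hint : ∀ i j, Integrable (fun z : 𝒳 × ℝ =>
      (1 / (πbar z.1).real {a}) * (g z.1 z.2 θstar i * g z.1 z.2 θstar j)) ν) (v : Vec d) :
    v ⬝ᵥ asympCov ν g θstar πbar a *ᵥ v =
      ∫ z, (1 / (πbar z.1).real {a}) *
        (inner ℝ v (meanDerivInv ν g θstar (g z.1 z.2 θstar))) ^ 2 ∂ν := by
  set B := (meanJacobian ν g θstar)⁻¹
  set w : Fin d → ℝ := Bᵀ *ᵥ v
  have h1 : v ⬝ᵥ asympCov ν g θstar πbar a *ᵥ v =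
      w ⬝ᵥ ipwSecondMoment ν g θstar πbar a *ᵥ w := by
    rw [asympCov, ← Matrix.mulVec_mulVec, ← Matrix.mulVec_mulVec, Matrix.dotProduct_mulVec,
      ← Matrix.mulVec_transpose]
  have h2 : ∀ x : Vec d, inner ℝ v (meanDerivInv ν g θstar x) = ∑ i, w i * x i := fun x => by
    rw [meanDerivInv, Matrix.inner_toEuclideanCLM, Matrix.dotProduct_mulVec,
      ← Matrix.mulVec_transpose]
    rfl
  have h3 : ∀ z : 𝒳 × ℝ, (1 / (πbar z.1).real {a}) *
      (inner ℝ v (meanDerivInv ν g θstar (g z.1 z.2 θstar))) ^ 2 =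
      ∑ i, ∑ j, w i * w j *
        ((1 / (πbar z.1).real {a}) * (g z.1 z.2 θstar i * g z.1 z.2 θstar j)) := fun z => by
    rw [h2, sq, Finset.sum_mul_sum, Finset.mul_sum]
    refine Finset.sum_congr rfl fun i _ => ?_
    rw [Finset.mul_sum]
    exact Finset.sum_congr rfl fun j _ => by ring
  simp_rw [h3]
  rw [h1, integral_finsetSum _ fun i _ => integrable_finsetSum _ fun j _ =>
    (hint i j).const_mul _]
  simp only [dotProduct, mulVec]
  refine Finset.sum_congr rfl fun i _ => ?_
  rw [integral_finsetSum _ fun j _ => (hint i j).const_mul _, Finset.mul_sum]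
  refine Finset.sum_congr rfl fun j _ => ?_
  rw [integral_const_mul, ipwSecondMoment, Matrix.of_apply]
  ring

lemma posSemidef_asympCov
    (hint : ∀ i j, Integrable (fun z : 𝒳 × ℝ =>
      (1 / (πbar z.1).real {a}) * (g z.1 z.2 θstar i * g z.1 z.2 θstar j)) ν) :
    (asympCov ν g θstar πbar a).PosSemidef := by
  rw [Matrix.posSemidef_iff_dotProduct_mulVec]
  refine ⟨?_, fun v => ?_⟩
  · have hI : (ipwSecondMoment ν g θstar πbar a).IsHermitian := by
      ext i j
      simp [ipwSecondMoment, mul_comm]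
    simpa [asympCov] using Matrix.isHermitian_mul_mul_conjTranspose (meanJacobian ν g θstar)⁻¹ hI
  · have h := dotProduct_asympCov_mulVec hint (WithLp.toLp 2 v)
    rw [star_trivial]
    refine h.symm ▸ integral_nonneg fun z => ?_
    exact mul_nonneg (one_div_nonneg.2 measureReal_nonneg) (sq_nonneg _)

end Covariance

/-! ### Asymptotic normality -/

namespace Experiment

variable {dX K d : ℕ} {𝒳 : Set (Vec dX)} {Ω : Type*} {D : Experiment 𝒳 K Ω}

lemma ipwMean_clm_comp {E F : Type*} [NormedAddCommGroup E] [NormedSpace ℝ E]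
    [NormedAddCommGroup F] [NormedSpace ℝ F] (a : Fin K) (L : E →L[ℝ] F) (f : 𝒳 × ℝ → E) (T : ℕ)
    (ω : Ω) : D.ipwMean a (fun z => L (f z)) T ω = L (D.ipwMean a f T ω) := by
  simp [ipwMean]

lemma measurable_stack : Measurable (stack : (Fin K → Vec d) → _) :=
  (WithLp.measurable_toLp 2 _).comp (by fun_prop)

lemma inner_stack (v : EuclideanSpace ℝ (Fin d × Fin K)) (θ : Fin K → Vec d) :
    inner ℝ v (stack θ) = ∑ a, inner ℝ (WithLp.toLp 2 fun i => v (i, a) : Vec d) (θ a) := by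
  simp only [PiLp.inner_apply, stack, Fintype.sum_prod_type]
  exact Finset.sum_comm

variable [mΩ : MeasurableSpace Ω] {P : Measure Ω} [IsProbabilityMeasure P]
  {Q : Measure (𝒳 × (Fin K → ℝ))} {π : Policy 𝒳 K} [∀ t, IsMarkovKernel (π t)]
  {πbar : Kernel 𝒳 (Fin K)} [IsMarkovKernel πbar]
  {g : Fin K → 𝒳 → ℝ → Vec d → Vec d} {θstar : Fin K → Vec d} {R : ℝ} {c : Fin K → ℝ}

/-- **Central limit theorem** for the stacked linear parts of the estimation errors. -/
lemma IsGenerated.tendstoInDistribution_linear_part (hD : D.IsGenerated P Q π)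
    (hU : D.Unconfounded P) (hconv : D.PolicyConverges P π πbar) (hc : ∀ a, 0 < c a)
    (hpos : ∀ a t, ∀ᵐ ω ∂P, c a ≤ D.prob π t a ω)
    (hg : ∀ a θ, Measurable (fun z : 𝒳 × ℝ => g a z.1 z.2 θ))
    (hroot : ∀ a, ∫ z, g a z.1 z.2 (θstar a) ∂(armLaw Q a) = 0)
    (hmom : ∀ a, BoundedMoments (armLaw Q a) (g a) (θstar a) R) :
    TendstoInDistribution (fun (T : ℕ) ω => stack fun a =>
        -meanDerivInv (armLaw Q a) (g a) (θstar a)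
          (√(T : ℝ) • D.ipwScore (g a) a T (θstar a) ω)) atTop id (fun _ => P)
      (multivariateGaussian 0
        (Matrix.blockDiagonal fun a => asympCov (armLaw Q a) (g a) (θstar a) πbar a)) := by
  have hprob := fun a => hD.isProbabilityMeasure_armLaw a
  have hg2 : ∀ a, MemLp (fun z : 𝒳 × ℝ => g a z.1 z.2 (θstar a)) 2 (armLaw Q a) := fun a =>
    (hmom a).memLp_two (hg a) (hmom a).norm_lt.le
  have hint : ∀ a i j, Integrable (fun z : 𝒳 × ℝ => (1 / (πbar z.1).real {a}) *
      (g a z.1 z.2 (θstar a) i * g a z.1 z.2 (θstar a) j)) (armLaw Q a) := by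
    intro a i j
    have hcoord : ∀ i, MemLp (fun z : 𝒳 × ℝ => g a z.1 z.2 (θstar a) i) 2 (armLaw Q a) :=
      fun i => (EuclideanSpace.proj (𝕜 := ℝ) i).comp_memLp' (hg2 a)
    exact integrable_one_div_policy_mul (half_pos (hc a))
      (hD.policy_limit_ge hconv (hc a) (hpos a)) (hcoord i) (hcoord j)
  have hm : ∀ T : ℕ, AEMeasurable (fun ω => stack fun a =>
      -meanDerivInv (armLaw Q a) (g a) (θstar a)
        (√(T : ℝ) • D.ipwScore (g a) a T (θstar a) ω)) P := by
    intro T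
    have hs : ∀ a, Measurable (D.ipwScore (g a) a T (θstar a)) := fun a =>
      (measurable_ipwScore (hg a) a T (θstar a)).mono (hD.measurable_hist T).comap_le le_rfl
    have h1 : ∀ a, Measurable (fun ω => -meanDerivInv (armLaw Q a) (g a) (θstar a)
        (√(T : ℝ) • D.ipwScore (g a) a T (θstar a) ω)) := fun a => by
      have := hs a
      fun_prop
    have h2 := measurable_stack.comp (measurable_pi_lambda _ h1)
    exact h2.aemeasurable
  refine ⟨hm, aemeasurable_id, ProbabilityMeasure.tendsto_iff_tendsto_charFun.2 fun v => ?_⟩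
  -- the test vector `v` against the influence function of each arm
  set ℓ : (a : Fin K) → Vec d →L[ℝ] ℝ := fun a =>
    -(innerSL ℝ (WithLp.toLp 2 fun i => v (i, a) : Vec d)).comp
      (meanDerivInv (armLaw Q a) (g a) (θstar a))
  have hclt := hD.tendsto_integral_cexp_ipwMean hU hconv hc hpos
    (f := fun a z => ℓ a (g a z.1 z.2 (θstar a)))
    (fun a => (ℓ a).measurable.comp (hg a (θstar a)))
    (fun a => (ℓ a).comp_memLp' ((hmom a).memLp_four (hg a)))
    (fun a => by
      rw [(ℓ a).integral_comp_comm ((hg2 a).integrable (by norm_num)), hroot a, map_zero])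
  have hvar : limitVar Q πbar (fun a z => ℓ a (g a z.1 z.2 (θstar a))) =
      v ⬝ᵥ (Matrix.blockDiagonal fun a => asympCov (armLaw Q a) (g a) (θstar a) πbar a) *ᵥ v := by
    rw [dotProduct_blockDiagonal_mulVec, limitVar]
    refine Finset.sum_congr rfl fun a _ => ?_
    rw [show (fun i => v (i, a)) = (WithLp.toLp 2 fun i => v (i, a) : Vec d) from rfl,
      dotProduct_asympCov_mulVec (hint a)]
    simp [ℓ]
  have hchar : ∀ T : ℕ, charFun (P.map fun ω => stack fun a =>
      -meanDerivInv (armLaw Q a) (g a) (θstar a)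
        (√(T : ℝ) • D.ipwScore (g a) a T (θstar a) ω)) v = ∫ ω, Complex.exp ((√(T : ℝ) *
      ∑ a, D.ipwMean a (fun z => ℓ a (g a z.1 z.2 (θstar a))) T ω : ℝ) * Complex.I) ∂P := by
    intro T
    rw [charFun_apply, integral_map (hm T) (by fun_prop)]
    refine integral_congr_ae (ae_of_all _ fun ω => ?_)
    beta_reduce
    rw [real_inner_comm, inner_stack, Finset.mul_sum]
    congr 4
    ext a
    rw [ipwMean_clm_comp, ← ipwScore_eq_ipwMean]
    simp [ℓ, inner_smul_right]
  simp only [ProbabilityMeasure.coe_mk, Measure.map_id, hchar]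
  rw [charFun_multivariateGaussian (posSemidef_blockDiagonal fun a => posSemidef_asympCov (hint a)),
    ← hvar]
  convert hclt using 3
  simp [neg_div]

/-- **Asymptotic normality** of approximate roots of the weighted estimating equations. -/
lemma IsGenerated.tendstoInDistribution_of_solves (hD : D.IsGenerated P Q π)
    (hU : D.Unconfounded P) (hconv : D.PolicyConverges P π πbar) (hc : ∀ a, 0 < c a)
    (hpos : ∀ a t, ∀ᵐ ω ∂P, c a ≤ D.prob π t a ω)
    (hg : ∀ a θ, Measurable (fun z : 𝒳 × ℝ => g a z.1 z.2 θ))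
    (hroot : ∀ a, ∫ z, g a z.1 z.2 (θstar a) ∂(armLaw Q a) = 0)
    (hsep : ∀ a, WellSeparated (armLaw Q a) (g a) (θstar a))
    (hmom : ∀ a, BoundedMoments (armLaw Q a) (g a) (θstar a) R)
    (hsm : ∀ a, SmoothScore (armLaw Q a) (g a) (θstar a) R) {θhat : Fin K → ℕ → Ω → Vec d}
    (hmeas : ∀ a T, AEMeasurable (θhat a T) P) (hR : ∀ a T, ∀ᵐ ω ∂P, ‖θhat a T ω‖ ≤ R)
    (hsol : ∀ a, D.SolvesIPW P (g a) a (θhat a)) :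
    TendstoInDistribution
      (fun (T : ℕ) ω => √(T : ℝ) • (stack (fun a => θhat a T ω) - stack θstar)) atTop id
      (fun _ => P) (multivariateGaussian 0
        (Matrix.blockDiagonal fun a => asympCov (armLaw Q a) (g a) (θstar a) πbar a)) := by
  refine tendstoInDistribution_of_tendstoInMeasure_sub _ _
    (hD.tendstoInDistribution_linear_part hU hconv hc hpos hg hroot hmom) ?_ fun T => ?_
  · refine tendstoInMeasure_zero_of_coord fun q => ?_
    refine tendstoInMeasure_zero_of_le (tendstoInMeasure_zero_norm
      (hD.tendstoInMeasure_linearization hU (hc q.2) (hpos q.2) (hg q.2) (hroot q.2) (hsep q.2)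
        (hmom q.2) (hsm q.2) (hR q.2) (hsol q.2)))
      (Eventually.of_forall fun T => ae_of_all _ fun ω => ?_)
    refine le_trans (le_of_eq ?_) (PiLp.norm_apply_le _ q.1)
    simp [stack]
  · have h : AEMeasurable (fun ω a => θhat a T ω) P := aemeasurable_pi_lambda _ fun a => hmeas a T
    have h1 := (measurable_stack.comp_aemeasurable h).sub_const (stack θstar)
    exact h1.const_smul (√(T : ℝ))

end Experiment

end AdaptiveInference

theorem theorem2 {Ω : Type*} [MeasurableSpace Ω] (P : Measure Ω) [IsProbabilityMeasure P]
    {dX K d : ℕ} (𝒳 : Set (Vec dX))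
    (Q : Measure (𝒳 × (Fin K → ℝ))) [IsProbabilityMeasure Q]
    (π : Policy 𝒳 K) [∀ t, IsMarkovKernel (π t)]
    (D : Experiment 𝒳 K Ω) (hD : D.IsGenerated P Q π)
    (hunconf : D.Unconfounded P)
    (g : Fin K → 𝒳 → ℝ → Vec d → Vec d)
    (hg : ∀ a θ, Measurable (fun z : 𝒳 × ℝ => g a z.1 z.2 θ))
    (θstar : Fin K → Vec d)
    (hroot : ∀ a, ∫ z, g a z.1 z.2 (θstar a) ∂(armLaw Q a) = 0)
    (R : ℝ)
    (hsep : ∀ a, WellSeparated (armLaw Q a) (g a) (θstar a))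
    (hmom : ∀ a, BoundedMoments (armLaw Q a) (g a) (θstar a) R)
    (hsmooth : ∀ a, SmoothScore (armLaw Q a) (g a) (θstar a) R)
    (hmin : ∀ a, D.MinSampling P π a)
    (πbar : Kernel 𝒳 (Fin K)) [IsMarkovKernel πbar]
    (hconv : D.PolicyConverges P π πbar) :
    (∃ θhat : Fin K → ℕ → Ω → Vec d,
      (∀ a T, Measurable[D.histSigma T] (θhat a T)) ∧
      (∀ a T ω, ‖θhat a T ω‖ ≤ R) ∧
      (∀ a, D.SolvesIPW P (g a) a (θhat a))) ∧
    (∀ θhat : Fin K → ℕ → Ω → Vec d,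
      (∀ a T, AEMeasurable (θhat a T) P) →
      (∀ a T, ∀ᵐ ω ∂P, ‖θhat a T ω‖ ≤ R) →
      (∀ a, D.SolvesIPW P (g a) a (θhat a)) →
      TendstoInDistribution
        (fun (T : ℕ) ω => √(T : ℝ) • (stack (fun a => θhat a T ω) - stack θstar))
        atTop id (fun _ => P)
        (multivariateGaussian 0
          (Matrix.blockDiagonal fun a => asympCov (armLaw Q a) (g a) (θstar a) πbar a))) := by
  choose c hc _ hpos using hmin
  refine ⟨?_, fun θhat hmeas hR hsol =>
    hD.tendstoInDistribution_of_solves hunconf hconv hc hpos hg hroot hsep hmom hsmooth hmeas hR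
      hsol⟩
  choose θhat hmeas hball hsol using fun a =>
    hD.exists_estimator hunconf (hc a) (hpos a) (hg a) (hroot a) (hmom a) (hsmooth a)
  exact ⟨θhat, hmeas, hball, hsol⟩
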